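/- Let $\mathcal P\subset\mathbb R^3$ be a convex polyhedron (the convex hull of finitely many points, with nonempty interior) all of whose edges have length $1$. Two distinct faces of $\mathcal P$ are adjacent if they have an edge of $\mathcal P$ in common. A net of $\mathcal P$ is an unfolding of the surface obtained by cutting it along a set of edges such that the pairs of faces still joined along an uncut edge form a spanning tree of the face adjacency graph; this tree is the dual graph of the net (the planar image of the unfolding is not required to be free of overlaps). A landscape $L(F\to G)$ is a path $F=F_{a_0},F_{a_1},\dots,F_{a_k}=G$, $k\ge 1$, in the dual graph of some net. If $F_n$ is a face in $L$ and $F_r$ is a face of $\mathcal P$ adjacent to $F_n$, let $u,v$ be the endpoints of their common edge, $v$ following $u$ in counter-clockwise rotation about the interior of $F_n$ seen from outside $\mathcal P$. The orientation $O=(L,F_n,F_r)$ is the unfolding of the faces of $L$ into $\mathbb R^2$ in which every face is mapped isometrically, consecutive faces agree on their common edge and lie on opposite sides of it, $F_n$ is mapped into the upper half-plane, and $u,v$ are mapped to $(0,0),(1,0)$. For a landscape $L(F\to G)$, $p\in F$ and $q\in G$, the trail $T_O(p,q)$ is the line segment in $\mathbb R^2$ joining the image of $p$ in the copy of $F$ to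 the image of $q$ in the copy of $G$, provided that this segment is contained in the unfolded landscape, i.e. that it splits into successive (possibly one-point) pieces lying in the copies of $F_{a_0},\dots,F_{a_k}$ in this order, consecutive pieces meeting on the copy of the common edge of the two faces. It is identified with the path on the surface of $\mathcal P$ obtained by folding these pieces back onto the faces. Theorem. Let $F_n$, $F_m$ be distinct faces of $\mathcal P$, let $F_r$ be a face of $\mathcal P$ adjacent to $F_n$, and let $p_1\in F_n\setminus F_m$ and $p_2\in F_m\setminus F_n$. Then there is a shortest path on the surface of $\mathcal P$ between $p_1$ and $p_2$, and for every such shortest path $\gamma$ there is a landscape $L=L(F_n\to F_m)$ with orientation $O=(L,F_n,F_r)$ such that $\gamma$ is, up to a monotone change of parameter, the trail $T_O(p_1,p_2)$ (in particular this trail exists). -/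

import Mathlib

open Set

/-- Three-dimensional Euclidean space. -/
abbrev E3 : Type := EuclideanSpace ℝ (Fin 3)

/-- The Euclidean plane. -/
abbrev E2 : Type := EuclideanSpace ℝ (Fin 2)

/-- `F` is a face of dimension `d` of the convex set `A`: the set of points of `A` at which some
linear functional attains its maximum on `A`. -/
def IsFaceOfDim (A : Set E3) (d : ℕ) (F : Set E3) : Prop :=
  F.Nonempty ∧ IsExposed ℝ A F ∧ Module.finrank ℝ (vectorSpan ℝ F) = d

/-- A convex unit polyhedron: the convex hull of finitely many points of space, with nonempty
interior, all of whose edges have length one. -/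
structure ConvexUnitPolyhedron where
  carrier : Set E3
  exists_finite : ∃ S : Set E3, S.Finite ∧ carrier = convexHull ℝ S
  interior_nonempty : (interior carrier).Nonempty
  edge_length : ∀ a b : E3, IsFaceOfDim carrier 1 (segment ℝ a b) → dist a b = 1

namespace ConvexUnitPolyhedron

/-- The surface of the polyhedron. -/
def surface (P : ConvexUnitPolyhedron) : Set E3 := frontier P.carrier

/-- The (two-dimensional, closed) faces of the polyhedron. -/
def Face (P : ConvexUnitPolyhedron) : Type := {F : Set E3 // IsFaceOfDim P.carrier 2 F}

/-- The set of points of a face. -/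
def Face.pts {P : ConvexUnitPolyhedron} (F : P.Face) : Set E3 := F.1

/-- The face adjacency graph of the polyhedron: two distinct faces are adjacent when they have an
edge of the polyhedron in common. -/
def faceGraph (P : ConvexUnitPolyhedron) : SimpleGraph P.Face where
  Adj F G := F ≠ G ∧ IsFaceOfDim P.carrier 1 (F.pts ∩ G.pts)
  symm := ⟨fun F G h => ⟨h.1.symm, by rw [Set.inter_comm]; exact h.2⟩⟩
  loopless := ⟨fun _ h => h.1 rfl⟩

/-- A net of the polyhedron, recorded through its dual graph: the surface is cut along some of the
edges so that it unfolds into one simply connected piece, that is, the pairs of faces which are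
still joined along an uncut edge form a spanning tree of the face adjacency graph. -/
structure Net (P : ConvexUnitPolyhedron) where
  dualGraph : SimpleGraph P.Face
  le_faceGraph : dualGraph ≤ P.faceGraph
  isTree : dualGraph.IsTree

/-- A landscape from the origin face `A` to the destination face `B`: a path with at least two
vertices in the dual graph of a net. -/
structure Landscape (P : ConvexUnitPolyhedron) (A B : P.Face) where
  net : P.Net
  path : net.dualGraph.Walk A B
  isPath : path.IsPath
  one_le_length : 1 ≤ path.length

namespace Landscape

variable {P : ConvexUnitPolyhedron} {A B : P.Face}

/-- The number of steps of the landscape; its faces are numbered `0, …, L.len`. -/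
def len (L : P.Landscape A B) : ℕ := L.path.length

/-- The `i`-th face of the landscape. -/
def face (L : P.Landscape A B) (i : ℕ) : P.Face := L.path.getVert i

end Landscape

/-- The determinant of three vectors of space. -/
noncomputable def det3 (a b c : E3) : ℝ := Matrix.det (Matrix.of fun i j => (![a, b, c] i) j)

/-- For the two endpoints `u`, `v` of an edge of the face `F`: `v` comes directly after `u` under
counter-clockwise rotation about the interior of `F`, seen from outside the polyhedron. (The
polyhedron lies behind the plane of `F` exactly when the determinants below are nonpositive.) -/
def IsCounterclockwise (P : ConvexUnitPolyhedron) (F : P.Face) (u v : E3) : Prop :=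
  ∀ x ∈ F.pts, ∀ y ∈ P.carrier, det3 (v - u) (x - u) (y - u) ≤ 0

/-- The orientation `(L, Fn, Fr)` of the landscape `L`: the unfolding of the faces of `L` into the
plane. `place F x` is the position in the plane of the point `x` of the face `F` of `L`; only
faces `F` of `L` and points `x` of `F` matter. Each face is mapped isometrically; consecutive faces
agree on their common edge and lie on opposite sides of it; `Fn` is mapped into the upper
half-plane, with the edge `uv` that it shares with `Fr` going to the edge from `(0,0)` to
`(1,0)`. -/
structure Orientation {P : ConvexUnitPolyhedron} {A B : P.Face} (L : P.Landscape A B)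
    (Fn Fr : P.Face) where
  mem : ∃ i ≤ L.len, L.face i = Fn
  adj : P.faceGraph.Adj Fn Fr
  place : P.Face → E3 → E2
  isometric : ∀ i ≤ L.len, ∀ x ∈ (L.face i).pts, ∀ y ∈ (L.face i).pts,
    dist (place (L.face i) x) (place (L.face i) y) = dist x y
  glued : ∀ i < L.len, ∀ x ∈ (L.face i).pts ∩ (L.face (i + 1)).pts,
    place (L.face i) x = place (L.face (i + 1)) x
  opposite : ∀ i < L.len, ∀ a b : E3, (L.face i).pts ∩ (L.face (i + 1)).pts = segment ℝ a b →
    ∀ x ∈ (L.face i).pts, ∀ y ∈ (L.face (i + 1)).pts,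
      (affineSpan ℝ {place (L.face i) a, place (L.face i) b}).WOppSide
        (place (L.face i) x) (place (L.face (i + 1)) y)
  base : ∃ u v : E3, Fn.pts ∩ Fr.pts = segment ℝ u v ∧ P.IsCounterclockwise Fn u v ∧
    place Fn u = !₂[0, 0] ∧ place Fn v = !₂[1, 0]
  upper : ∀ x ∈ Fn.pts, 0 ≤ place Fn x 1

namespace Orientation

variable {P : ConvexUnitPolyhedron} {A B Fn Fr : P.Face} {L : P.Landscape A B}

/-- The subset of the plane covered by the oriented landscape. -/
def region (O : Orientation L Fn Fr) : Set E2 :=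
  {z | ∃ i ≤ L.len, ∃ x ∈ (L.face i).pts, O.place (L.face i) x = z}

/-- The line segment in the plane from the position of the point `p` of the origin face to the
position of the point `q` of the destination face. It is called the trail from `p` to `q` when it
is contained in the oriented landscape. -/
def trail (O : Orientation L Fn Fr) (p q : E3) : Set E2 := segment ℝ (O.place A p) (O.place B q)

/-- The curve `γ`, parametrized by `[0, 1]`, is the trail from `p` to `q` in `O`, folded back onto
the surface of the polyhedron. The trail lies in the oriented landscape; it is divided, at
parameters `0 = τ 0 ≤ τ 1 ≤ ⋯ ≤ 1`, into successive (possibly one-point) pieces, the `i`-th of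
which lies in the copy of the `i`-th face; and `γ` is obtained, up to a monotone change of parameter
`φ`, by folding back each of these pieces to that face. -/
def IsFoldedTrail (O : Orientation L Fn Fr) (p q : E3) (γ : ℝ → E3) : Prop :=
  O.trail p q ⊆ O.region ∧
  ∃ τ : ℕ → ℝ, Monotone τ ∧ τ 0 = 0 ∧ τ (L.len + 1) = 1 ∧
  ∃ φ : ℝ → ℝ, MonotoneOn φ (Icc 0 1) ∧ ContinuousOn φ (Icc 0 1) ∧ φ 0 = 0 ∧ φ 1 = 1 ∧
    ∀ i ≤ L.len, ∀ t ∈ Icc (0 : ℝ) 1, φ t ∈ Icc (τ i) (τ (i + 1)) →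
      γ t ∈ (L.face i).pts ∧
      O.place (L.face i) (γ t) = AffineMap.lineMap (O.place A p) (O.place B q) (φ t)

end Orientation

/-- `γ`, restricted to `[0, 1]`, is a continuous path on the surface from `p` to `q`. -/
structure IsSurfacePath (P : ConvexUnitPolyhedron) (p q : E3) (γ : ℝ → E3) : Prop where
  continuousOn : ContinuousOn γ (Icc 0 1)
  mem_surface : ∀ t ∈ Icc (0 : ℝ) 1, γ t ∈ P.surface
  source : γ 0 = p
  target : γ 1 = q

/-- `γ` is a shortest path on the surface from `p` to `q`: no path on the surface from `p` to `q`
has a smaller length (total variation). -/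
def IsShortestPath (P : ConvexUnitPolyhedron) (p q : E3) (γ : ℝ → E3) : Prop :=
  P.IsSurfacePath p q γ ∧
  ∀ η : ℝ → E3, P.IsSurfacePath p q η → eVariationOn γ (Icc 0 1) ≤ eVariationOn η (Icc 0 1)

end ConvexUnitPolyhedron

/-! Existence is a compactness argument. Straightening a path from its current point to its last
visit in a face, face after face, yields a chain of chords lying in faces, no longer than the path
and with at most as many sides as there are faces (`IsSurfacePath.exists_chain`). Such chains form a
compact set on which length is continuous.

The local theory rests on one device: nearest-point projection onto a convex body does not increase
length, so a path outside the interior projects to a competitor on the surface (`pathLE_proj`).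
Pushing a broken line outwards and comparing lengths to first order (`IsGeodesicAt.first_variation`)
shows that a shortest path makes equal angles with an edge it crosses (`IsGeodesicAt.inner_eq_zero`)
and meets no vertex away from its endpoints (`IsShortestPath.notMem_exposedPoints`).

A shortest path is straight within each face and visits it during one interval of time, so it runs
through finitely many faces. Distinct faces meeting at a point that is not a vertex are adjacent. A
vertex can occur only at an endpoint, and there the faces around it are linked through adjacent ones
(`reflTransGen_of_mem`), as a shortest path close to the vertex shows. A shortest sequence of faces
has no repetition, so its edges are acyclic and extend to a spanning tree, which gives the landscape
(`exists_landscape`).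

The faces are unfolded one after another (`exists_unfolds`). Equal angles at an edge mean equal
directions in the plane, so the unfolded path is a straight segment run with unit speed in arc
length (`IsShortestPath.exists_direction`). Arc length divided by total length is the change of
parameter. -/

namespace ConvexUnitPolyhedron

/-! ### Supporting functionals, faces and edges. -/

variable (P : ConvexUnitPolyhedron)

lemma isCompact_carrier : IsCompact P.carrier := by
  obtain ⟨S, hS, h⟩ := P.exists_finite
  rw [h]
  exact hS.isCompact_convexHull ℝ

lemma isClosed_carrier : IsClosed P.carrier := P.isCompact_carrier.isClosed

lemma convex_carrier : Convex ℝ P.carrier := by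
  obtain ⟨S, hS, h⟩ := P.exists_finite
  rw [h]
  exact convex_convexHull ℝ S

lemma surface_eq : P.surface = P.carrier \ interior P.carrier :=
  P.isClosed_carrier.frontier_eq

lemma surface_subset : P.surface ⊆ P.carrier := by
  rw [surface_eq]; exact sdiff_subset

lemma isCompact_surface : IsCompact P.surface :=
  P.isCompact_carrier.of_isClosed_subset isClosed_frontier P.surface_subset

/-- A nonzero functional which is bounded by `c` on the polyhedron is less than `c` in its
interior. -/
lemma lt_of_mem_interior {l : StrongDual ℝ E3} (hl : l ≠ 0) {c : ℝ}
    (hc : ∀ y ∈ P.carrier, l y ≤ c) {x : E3} (hx : x ∈ interior P.carrier) : l x < c := by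
  have ho : IsOpenMap l := l.isOpenMap_of_ne_zero hl
  have h1 : l '' interior P.carrier ⊆ interior (Iic c) := by
    refine interior_maximal ?_ (ho _ isOpen_interior)
    rintro _ ⟨y, hy, rfl⟩
    exact hc y (interior_subset hy)
  have := h1 ⟨x, hx, rfl⟩
  simpa using this

lemma notMem_interior {l : StrongDual ℝ E3} (hl : l ≠ 0) {c : ℝ}
    (hc : ∀ y ∈ P.carrier, l y ≤ c) {x : E3} (hx : c ≤ l x) : x ∉ interior P.carrier :=
  fun h => (P.lt_of_mem_interior hl hc h).not_ge hx

lemma le_of_le_on {S : Set E3} (h : P.carrier = convexHull ℝ S) (l : StrongDual ℝ E3) (c : ℝ)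
    (hc : ∀ s ∈ S, l s ≤ c) : ∀ y ∈ P.carrier, l y ≤ c := by
  rw [h]
  exact convexHull_min (t := {y | l y ≤ c}) hc
    (convex_halfSpace_le l.toLinearMap.isLinear c)

variable {P}

/-- The functional cannot vanish: otherwise the face would be the whole polyhedron, which has
dimension three because its interior is nonempty. -/
lemma Face.exists_functional (F : P.Face) : ∃ l : StrongDual ℝ E3, ∃ c : ℝ, l ≠ 0 ∧
    (∀ y ∈ P.carrier, l y ≤ c) ∧ ∀ x, x ∈ F.pts ↔ x ∈ P.carrier ∧ l x = c := by
  obtain ⟨F, ⟨w, hw⟩, hF, hd⟩ := F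
  obtain ⟨l, hl⟩ := hF ⟨w, hw⟩
  have hwl := hw
  rw [hl] at hwl
  have key : ∀ x, x ∈ F ↔ x ∈ P.carrier ∧ l x = l w := by
    intro x
    rw [hl]
    constructor
    · rintro ⟨h1, h2⟩
      exact ⟨h1, le_antisymm (hwl.2 x h1) (h2 w hwl.1)⟩
    · rintro ⟨h1, h2⟩
      exact ⟨h1, fun y hy => h2 ▸ hwl.2 y hy⟩
  refine ⟨l, l w, ?_, hwl.2, key⟩
  rintro rfl
  have : F = P.carrier := by ext x; simpa using key x
  rw [this] at hd
  have h3 : vectorSpan ℝ P.carrier = ⊤ := by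
    have hne := P.interior_nonempty
    have := affineSpan_eq_top_of_nonempty_interior (V := E3)
      (s := P.carrier) (by rwa [P.convex_carrier.convexHull_eq])
    rw [← direction_affineSpan, this, AffineSubspace.direction_top]
  rw [h3, finrank_top] at hd
  simp at hd

/-- An outer normal functional of a face. -/
noncomputable def Face.normal (F : P.Face) : StrongDual ℝ E3 := F.exists_functional.choose

/-- The value of the normal functional on the face. -/
noncomputable def Face.height (F : P.Face) : ℝ := F.exists_functional.choose_spec.choose

namespace Face

variable (F G : P.Face)

lemma normal_ne_zero : F.normal ≠ 0 := F.exists_functional.choose_spec.choose_spec.1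

variable {F G}

lemma normal_le {y : E3} (hy : y ∈ P.carrier) : F.normal y ≤ F.height :=
  F.exists_functional.choose_spec.choose_spec.2.1 y hy

lemma mem_iff {x : E3} : x ∈ F.pts ↔ x ∈ P.carrier ∧ F.normal x = F.height :=
  F.exists_functional.choose_spec.choose_spec.2.2 x

lemma normal_eq {x : E3} (hx : x ∈ F.pts) : F.normal x = F.height := (mem_iff.1 hx).2

variable (F G)

lemma subset_carrier : F.pts ⊆ P.carrier := fun _ hx => (mem_iff.1 hx).1

lemma nonempty : F.pts.Nonempty := F.2.1

lemma isExposed : IsExposed ℝ P.carrier F.pts := F.2.2.1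

lemma finrank_eq : Module.finrank ℝ (vectorSpan ℝ F.pts) = 2 := F.2.2.2

lemma isCompact : IsCompact F.pts := F.isExposed.isCompact P.isCompact_carrier

lemma convex : Convex ℝ F.pts := F.isExposed.convex P.convex_carrier

variable {F G}

lemma notMem_interior {x : E3} (h : F.height ≤ F.normal x) : x ∉ interior P.carrier :=
  P.notMem_interior F.normal_ne_zero (fun _ hy => normal_le hy) h

variable (F G)

lemma subset_surface : F.pts ⊆ P.surface := fun x hx => by
  rw [surface_eq]
  exact ⟨F.subset_carrier hx, notMem_interior (normal_eq hx).ge⟩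

end Face

lemma finrank_ker_eq_two {l : StrongDual ℝ E3} (hl : l ≠ 0) :
    Module.finrank ℝ (LinearMap.ker l.toLinearMap) = 2 := by
  have h1 := LinearMap.finrank_range_add_finrank_ker l.toLinearMap
  have h2 : Module.finrank ℝ (LinearMap.range l.toLinearMap) = 1 := by
    rw [LinearMap.range_eq_top.2]
    · simp
    · apply LinearMap.surjective
      intro h
      exact hl (ContinuousLinearMap.coe_injective h)
  have h3 : Module.finrank ℝ E3 = 3 := by simp
  omega

lemma vectorSpan_le_ker {A : Set E3} {l : StrongDual ℝ E3} {c : ℝ} (h : ∀ x ∈ A, l x = c) :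
    vectorSpan ℝ A ≤ LinearMap.ker l.toLinearMap := by
  rw [vectorSpan, Submodule.span_le]
  rintro _ ⟨x, hx, y, hy, rfl⟩
  simp [h x hx, h y hy]

lemma Face.vectorSpan_eq (F : P.Face) :
    vectorSpan ℝ F.pts = LinearMap.ker F.normal.toLinearMap :=
  Submodule.eq_of_le_of_finrank_eq (vectorSpan_le_ker fun _ hx => Face.normal_eq hx)
    (by rw [F.finrank_eq, finrank_ker_eq_two F.normal_ne_zero])

lemma Face.ext {F G : P.Face} (h : F.pts = G.pts) : F = G := Subtype.ext h

/-- Two faces with points `x` in common and the same normal directions coincide. -/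
lemma Face.subset_of_vectorSpan_le {F G : P.Face} {x : E3} (hx : x ∈ F.pts ∩ G.pts)
    (h : vectorSpan ℝ F.pts ≤ vectorSpan ℝ G.pts) : F.pts ⊆ G.pts := by
  intro y hy
  have h1 : y - x ∈ vectorSpan ℝ F.pts := vsub_mem_vectorSpan ℝ hy hx.1
  have h2 := h h1
  rw [G.vectorSpan_eq] at h2
  refine Face.mem_iff.2 ⟨F.subset_carrier hy, ?_⟩
  have h3 : G.normal (y - x) = 0 := h2
  rw [map_sub, Face.normal_eq hx.2, sub_eq_zero] at h3
  exact h3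

lemma Face.eq_of_vectorSpan_eq {F G : P.Face} {x : E3} (hx : x ∈ F.pts ∩ G.pts)
    (h : vectorSpan ℝ F.pts = vectorSpan ℝ G.pts) : F = G :=
  Face.ext (Subset.antisymm (Face.subset_of_vectorSpan_le hx h.le)
    (Face.subset_of_vectorSpan_le hx.symm h.ge))

lemma Face.finrank_inter_le {F G : P.Face} (hFG : F ≠ G) (hne : (F.pts ∩ G.pts).Nonempty) :
    Module.finrank ℝ (vectorSpan ℝ (F.pts ∩ G.pts)) ≤ 1 := by
  obtain ⟨x, hx⟩ := hne
  by_contra! h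
  have h1 : vectorSpan ℝ (F.pts ∩ G.pts) = vectorSpan ℝ F.pts :=
    Submodule.eq_of_le_of_finrank_le (vectorSpan_mono ℝ inter_subset_left)
      (by rw [F.finrank_eq]; omega)
  have h2 : vectorSpan ℝ (F.pts ∩ G.pts) = vectorSpan ℝ G.pts :=
    Submodule.eq_of_le_of_finrank_le (vectorSpan_mono ℝ inter_subset_right)
      (by rw [G.finrank_eq]; omega)
  exact hFG (Face.eq_of_vectorSpan_eq hx (h1.symm.trans h2))

/-- Two faces with a common point which is not a vertex are equal or adjacent. -/
lemma adj_of_mem {F G : P.Face} (hFG : F ≠ G) {x : E3} (hx : x ∈ F.pts ∩ G.pts)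
    (hv : x ∉ P.carrier.exposedPoints ℝ) : P.faceGraph.Adj F G := by
  refine ⟨hFG, ⟨x, hx⟩, F.isExposed.inter G.isExposed, ?_⟩
  have h1 := Face.finrank_inter_le hFG ⟨x, hx⟩
  by_contra h
  have h2 : Module.finrank ℝ (vectorSpan ℝ (F.pts ∩ G.pts)) = 0 := by omega
  rw [Submodule.finrank_eq_zero, vectorSpan_eq_bot_iff_subsingleton] at h2
  apply hv
  rw [mem_exposedPoints_iff_exposed_singleton, ← h2.eq_singleton_of_mem hx]
  exact F.isExposed.inter G.isExposed

/-- A functional which is maximal at `x`, together with a direction in which it can be tilted,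
yields one which is maximal on a set of greater dimension. -/
lemma exists_tilt {S : Set E3} (hS : S.Finite) (hPS : P.carrier = convexHull ℝ S) {x : E3}
    (hx : x ∈ P.carrier) {f : StrongDual ℝ E3} (hf : f ≠ 0) (hfx : ∀ y ∈ P.carrier, f y ≤ f x)
    (hd : Module.finrank ℝ (vectorSpan ℝ {y ∈ P.carrier | f y = f x}) < 2) :
    ∃ f' : StrongDual ℝ E3, f' ≠ 0 ∧ (∀ y ∈ P.carrier, f' y ≤ f' x) ∧
      Module.finrank ℝ (vectorSpan ℝ {y ∈ P.carrier | f y = f x}) <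
        Module.finrank ℝ (vectorSpan ℝ {y ∈ P.carrier | f' y = f' x}) := by
  set A := {y ∈ P.carrier | f y = f x} with hA
  set V := vectorSpan ℝ A with hV
  have hxA : x ∈ A := ⟨hx, rfl⟩
  have hVker : V ≤ LinearMap.ker f.toLinearMap := vectorSpan_le_ker fun y hy => hy.2
  obtain ⟨e, hef, heV⟩ : ∃ e ∈ LinearMap.ker f.toLinearMap, e ∉ V := by
    by_contra! h
    have := Submodule.finrank_mono (R := ℝ) (s := LinearMap.ker f.toLinearMap) (t := V) h
    rw [finrank_ker_eq_two hf] at this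
    omega
  obtain ⟨e', he'0, he'f, he'V⟩ : ∃ e' : E3, e' ≠ 0 ∧ f e' = 0 ∧ ∀ v ∈ V, inner ℝ e' v = 0 := by
    refine ⟨e - V.starProjection e, ?_, ?_, ?_⟩
    · intro h
      rw [sub_eq_zero] at h
      exact heV (h ▸ V.starProjection_apply_mem e)
    · rw [map_sub]
      have h1 : f e = 0 := hef
      have h2 : f (V.starProjection e) = 0 := hVker (V.starProjection_apply_mem e)
      rw [h1, h2, sub_zero]
    · intro v hv
      exact V.starProjection_inner_eq_zero e v hv
  -- `g` is constant on the contact set, so tilting by it loses no contact point. Its sign is chosen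
  -- so that some point of `S` lies beyond `x`; if neither sign worked, `inner ℝ e'` would be
  -- constant on a set with interior.
  obtain ⟨g, hgV, ⟨s₁, hs₁, hgs₁⟩, hg0⟩ : ∃ g : StrongDual ℝ E3, (∀ v ∈ V, g v = 0) ∧
      (∃ s ∈ S, g x < g s) ∧ ∀ t : ℝ, f + t • g ≠ 0 := by
    have h0 : ∀ t : ℝ, ∀ g : StrongDual ℝ E3, g e' ≠ 0 → f + t • g ≠ 0 := by
      intro t g hg h
      have h1 : (f + t • g) e' = 0 := by rw [h]; rfl
      have h2 : t = 0 := by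
        simpa [he'f, hg] using h1
      rw [h2, zero_smul, add_zero] at h
      exact hf h
    have hne : inner ℝ e' e' ≠ 0 := by simpa using he'0
    by_cases h : ∃ s ∈ S, inner ℝ e' x < inner ℝ e' s
    · exact ⟨innerSL ℝ e', fun v hv => by simpa using he'V v hv, by simpa using h,
        fun t => h0 t _ (by simpa using hne)⟩
    · push Not at h
      refine ⟨-innerSL ℝ e', fun v hv => by simpa using he'V v hv, ?_,
        fun t => h0 t _ (by simpa using hne)⟩
      by_contra! h'
      have h3 : ∀ y ∈ P.carrier, innerSL ℝ e' y ≤ inner ℝ e' x :=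
        P.le_of_le_on hPS _ _ fun s hs => by simpa using h s hs
      have h4 : ∀ y ∈ P.carrier, (-innerSL ℝ e') y ≤ -inner ℝ e' x :=
        P.le_of_le_on hPS _ _ fun s hs => by simpa using h' s hs
      obtain ⟨o, ho⟩ := P.interior_nonempty
      have h5 : innerSL ℝ e' ≠ 0 := fun h => by
        apply hne
        rw [← innerSL_apply_apply ℝ, h]; rfl
      have h6 := P.lt_of_mem_interior h5 h3 ho
      have h7 := h4 o (interior_subset ho)
      simp at h6 h7
      linarith
  -- The tilt stops at the least `t` for which a point of `S` beyond `x` reaches the supporting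
  -- plane. That point `s₀` joins the contact set, and `g s₀ ≠ g x` makes the dimension grow.
  have hTfin : {s ∈ S | g x < g s}.Finite := hS.subset fun _ h => h.1
  obtain ⟨s₀, ⟨hs₀, hgs₀⟩, hmin⟩ := hTfin.exists_minimalFor
    (fun s => (f x - f s) / (g s - g x)) _ ⟨s₁, hs₁, hgs₁⟩
  set t := (f x - f s₀) / (g s₀ - g x) with ht
  have hSP : S ⊆ P.carrier := hPS ▸ subset_convexHull ℝ S
  have ht0 : 0 ≤ t := div_nonneg (by linarith [hfx s₀ (hSP hs₀)]) (by linarith)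
  have hle : ∀ y ∈ P.carrier, (f + t • g) y ≤ (f + t • g) x := by
    refine P.le_of_le_on hPS _ _ fun s hs => ?_
    simp only [add_apply, smul_apply, smul_eq_mul]
    rcases le_or_gt (g s) (g x) with h | h
    · nlinarith [hfx s (hSP hs)]
    · have h1 : t ≤ (f x - f s) / (g s - g x) := by
        by_contra! h2
        exact absurd (hmin ⟨hs, h⟩ h2.le) (not_le.2 h2)
      rw [le_div_iff₀ (by linarith)] at h1
      nlinarith
  refine ⟨f + t • g, hg0 t, hle, ?_⟩
  apply Submodule.finrank_lt_finrank_of_lt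
  rw [SetLike.lt_iff_le_and_exists]
  have hgA : ∀ y ∈ A, g y = g x := fun y hy => by
    have := hgV (y - x) (vsub_mem_vectorSpan ℝ hy hxA)
    rw [map_sub] at this
    linarith
  refine ⟨vectorSpan_mono ℝ ?_, s₀ - x, ?_, ?_⟩
  · rintro y hy
    refine ⟨hy.1, ?_⟩
    simp [hy.2, hgA y hy]
  · refine vsub_mem_vectorSpan ℝ ⟨hSP hs₀, ?_⟩ ⟨hx, rfl⟩
    have : t * (g s₀ - g x) = f x - f s₀ := by rw [ht]; field_simp [(by linarith : g s₀ - g x ≠ 0)]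
    simp only [add_apply, smul_apply, smul_eq_mul]
    linarith
  · intro h
    have := hgV _ h
    rw [map_sub] at this
    linarith

/-- Hahn–Banach supplies a supporting functional at `x`, and `exists_tilt` raises the dimension of
its contact set to two. It cannot be more, since the contact set lies in a plane. -/
lemma exists_face_of_mem_surface {x : E3} (hx : x ∈ P.surface) : ∃ F : P.Face, x ∈ F.pts := by
  obtain ⟨S, hS, hPS⟩ := P.exists_finite
  rw [surface_eq] at hx
  obtain ⟨f, hf⟩ := geometric_hahn_banach_open_point P.convex_carrier.interior isOpen_interior hx.2
  have hf0 : f ≠ 0 := by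
    rintro rfl
    obtain ⟨o, ho⟩ := P.interior_nonempty
    simpa using hf o ho
  have hfx : ∀ y ∈ P.carrier, f y ≤ f x := by
    intro y hy
    have h1 : y ∈ closure (interior P.carrier) := by
      rw [P.convex_carrier.closure_interior_eq_closure_of_nonempty_interior P.interior_nonempty]
      exact subset_closure hy
    exact closure_minimal (t := {y | f y ≤ f x}) (fun a ha => (hf a ha).le)
      (isClosed_le f.continuous continuous_const) h1
  have hk : ∀ k ≤ 2, ∃ f' : StrongDual ℝ E3, f' ≠ 0 ∧ (∀ y ∈ P.carrier, f' y ≤ f' x) ∧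
      k ≤ Module.finrank ℝ (vectorSpan ℝ {y ∈ P.carrier | f' y = f' x}) := by
    intro k
    induction k with
    | zero => exact fun _ => ⟨f, hf0, hfx, Nat.zero_le _⟩
    | succ k ih =>
      intro hk
      obtain ⟨f', h1, h2, h3⟩ := ih (by omega)
      by_cases h4 : k + 1 ≤ Module.finrank ℝ (vectorSpan ℝ {y ∈ P.carrier | f' y = f' x})
      · exact ⟨f', h1, h2, h4⟩
      · obtain ⟨f'', h5, h6, h7⟩ := exists_tilt hS hPS hx.1 h1 h2 (by omega)
        exact ⟨f'', h5, h6, by omega⟩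
  obtain ⟨f', h1, h2, h3⟩ := hk 2 le_rfl
  have h4 := Submodule.finrank_mono (vectorSpan_le_ker
    (A := {y ∈ P.carrier | f' y = f' x}) (l := f') (c := f' x) fun y hy => hy.2)
  rw [finrank_ker_eq_two h1] at h4
  refine ⟨⟨{y ∈ P.carrier | f' y = f' x}, ⟨x, hx.1, rfl⟩, fun _ => ⟨f', ?_⟩, by omega⟩, hx.1, rfl⟩
  ext y
  refine and_congr_right fun hy => ⟨fun h z hz => h ▸ h2 z hz, fun h => ?_⟩
  exact le_antisymm (h2 y hy) (h x hx.1)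

lemma Face.subset_convexHull {S : Set E3} (hPS : P.carrier = convexHull ℝ S) (F : P.Face) :
    F.pts ⊆ convexHull ℝ (S ∩ F.pts) := by
  have hSP : S ⊆ P.carrier := hPS ▸ _root_.subset_convexHull ℝ S
  -- The right-hand side contains `S` and is convex: a proper combination involving a point strictly
  -- below the plane is strictly below it.
  have h1 : P.carrier ⊆ {y | F.normal y < F.height} ∪
      ({y | F.normal y = F.height} ∩ convexHull ℝ (S ∩ F.pts)) := by
    conv_lhs => rw [hPS]
    refine convexHull_min ?_ ?_
    · intro s hs
      rcases (Face.normal_le (F := F) (hSP hs)).lt_or_eq with h | h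
      · exact Or.inl h
      · exact Or.inr ⟨h, _root_.subset_convexHull ℝ _ ⟨hs, Face.mem_iff.2 ⟨hSP hs, h⟩⟩⟩
    · rw [convex_iff_forall_pos]
      intro y hy z hz a b ha hb hab
      have hb' : b = 1 - a := by linarith
      subst hb'
      rcases hy with hy | hy <;> rcases hz with hz | hz
      · left
        simp only [mem_ofPred_eq, map_add, map_smul, smul_eq_mul] at *
        nlinarith
      · left
        replace hz := hz.1
        simp only [mem_ofPred_eq, map_add, map_smul, smul_eq_mul] at *
        nlinarith
      · left
        replace hy := hy.1
        simp only [mem_ofPred_eq, map_add, map_smul, smul_eq_mul] at *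
        nlinarith
      · right
        refine ⟨?_, convex_convexHull ℝ _ hy.2 hz.2 ha.le hb.le hab⟩
        replace hz := hz.1
        replace hy := hy.1
        simp only [mem_ofPred_eq, map_add, map_smul, smul_eq_mul] at *
        rw [hy, hz]; ring
  intro y hy
  rcases h1 (F.subset_carrier hy) with h | h
  · exact absurd (Face.normal_eq hy) (ne_of_lt h)
  · exact h.2

/-- A face is determined by the points it contains of a finite generating set. -/
instance : Finite P.Face := by
  obtain ⟨S, hS, hPS⟩ := P.exists_finite
  have : Finite {T // T ⊆ S} := hS.finite_subsets
  refine Finite.of_injective (β := {T // T ⊆ S}) (fun F => ⟨S ∩ F.pts, inter_subset_left⟩) ?_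
  have key : ∀ F G : P.Face, S ∩ F.pts = S ∩ G.pts → F.pts ⊆ G.pts := fun F G h =>
    (F.subset_convexHull hPS).trans (convexHull_min (h ▸ inter_subset_right) G.convex)
  intro F G h
  have h' : S ∩ F.pts = S ∩ G.pts := congrArg Subtype.val h
  exact Face.ext (Subset.antisymm (key F G h') (key G F h'.symm))

/-- At a vertex, some supporting functional is positive on a given vector or on its opposite. -/
lemma exists_supporting_of_exposed {v : E3} (hv : v ∈ P.carrier.exposedPoints ℝ) {d : E3}
    (hd : d ≠ 0) : ∃ l : StrongDual ℝ E3, l ≠ 0 ∧ (∀ y ∈ P.carrier, l y ≤ l v) ∧ l d ≠ 0 := by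
  obtain ⟨hvK, f, hf⟩ := hv
  by_cases hfd : f d = 0
  swap
  · exact ⟨f, fun h => hfd (by rw [h]; rfl), fun y hy => (hf y hy).1, hfd⟩
  obtain ⟨S, hS, hPS⟩ := P.exists_finite
  have hSP : S ⊆ P.carrier := hPS ▸ subset_convexHull ℝ S
  -- The exposing functional is strictly smaller at the other points of the finite set `S`, so a
  -- small tilt towards `d` still supports at `v`.
  have hε : ∀ᶠ ε in nhdsWithin (0 : ℝ) (Ioi 0), ∀ s ∈ S, (f + ε • innerSL ℝ d) s ≤
      (f + ε • innerSL ℝ d) v := by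
    rw [Filter.eventually_all_finite hS]
    intro s hs
    by_cases hsv : s = v
    · simp [hsv]
    have h1 : f s < f v := by
      by_contra! h
      exact hsv ((hf s (hSP hs)).2 h)
    have h2 : ∀ᶠ ε in nhds (0 : ℝ), (f + ε • innerSL ℝ d) s < (f + ε • innerSL ℝ d) v := by
      have c1 : Continuous fun ε : ℝ => (f + ε • innerSL ℝ d) s := by
        simp only [add_apply, smul_apply, smul_eq_mul]
        fun_prop
      have c2 : Continuous fun ε : ℝ => (f + ε • innerSL ℝ d) v := by
        simp only [add_apply, smul_apply, smul_eq_mul]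
        fun_prop
      exact c1.continuousAt.eventually_lt c2.continuousAt (by simpa using h1)
    exact (h2.filter_mono nhdsWithin_le_nhds).mono fun _ h => h.le
  obtain ⟨ε, hε, hε0⟩ := (hε.and self_mem_nhdsWithin).exists
  have hd' : (f + ε • innerSL ℝ d) d ≠ 0 := by
    have : ε ≠ 0 := ne_of_gt hε0
    simp [hfd, this, hd]
  exact ⟨f + ε • innerSL ℝ d, fun h => hd' (by rw [h]; rfl), P.le_of_le_on hPS _ _ hε, hd'⟩

lemma exists_eq_segment {A : Set E3} (hne : A.Nonempty) (hc : IsCompact A) (hA : Convex ℝ A)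
    (hd : Module.finrank ℝ (vectorSpan ℝ A) = 1) : ∃ u v : E3, A = segment ℝ u v := by
  obtain ⟨x, hx⟩ := hne
  obtain ⟨⟨w, hw⟩, hw0, hspan⟩ := finrank_eq_one_iff'.1 hd
  have hw0' : w ≠ 0 := fun h => hw0 (Subtype.ext h)
  have key : ∀ y ∈ A, ∃ t : ℝ, y = AffineMap.lineMap x (x + w) t := by
    intro y hy
    obtain ⟨t, ht⟩ := hspan ⟨y - x, vsub_mem_vectorSpan ℝ hy hx⟩
    refine ⟨t, ?_⟩
    have : t • w = y - x := congrArg Subtype.val ht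
    simp [AffineMap.lineMap_apply, this]
  let φ : ℝ →ᵃ[ℝ] E3 := AffineMap.lineMap x (x + w)
  have hφ : Continuous φ := AffineMap.lineMap_continuous
  have hφe : Topology.IsClosedEmbedding φ := by
    have : φ = (fun y => x + y) ∘ (fun t : ℝ => t • w) := by
      ext t
      simp [φ, AffineMap.lineMap_apply, add_comm]
    rw [this]
    exact (Homeomorph.addLeft x).isClosedEmbedding.comp (isClosedEmbedding_smul_left hw0')
  have hB : IsCompact (φ ⁻¹' A) := hφe.isCompact_preimage hc
  have hBc : Convex ℝ (φ ⁻¹' A) := hA.affine_preimage φ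
  have hBn : (φ ⁻¹' A).Nonempty := ⟨0, by simpa [φ] using hx⟩
  obtain ⟨a, b, hab, hBab⟩ : ∃ a b : ℝ, a ≤ b ∧ φ ⁻¹' A = Icc a b := by
    refine ⟨sInf (φ ⁻¹' A), sSup (φ ⁻¹' A), ?_, ?_⟩
    · exact csInf_le_csSup hBn hB.bddBelow hB.bddAbove
    · exact eq_Icc_of_connected_compact ⟨hBn, hBc.isPreconnected⟩ hB
  refine ⟨φ a, φ b, ?_⟩
  rw [← image_segment, segment_eq_Icc hab, ← hBab, image_preimage_eq_inter_range]
  refine (inter_eq_left.2 fun y hy => ?_).symm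
  obtain ⟨t, rfl⟩ := key y hy
  exact ⟨t, rfl⟩

/-- The unit edge length enters here. It makes `v - u` a unit vector of the frames used below and
lets the base edge go from `(0,0)` to `(1,0)`. -/
lemma exists_edge {F G : P.Face} (h : P.faceGraph.Adj F G) :
    ∃ u v : E3, F.pts ∩ G.pts = segment ℝ u v ∧ dist u v = 1 := by
  obtain ⟨-, hF⟩ := h
  obtain ⟨u, v, huv⟩ := exists_eq_segment hF.1 (F.isCompact.inter G.isCompact)
    (F.convex.inter G.convex) hF.2.2
  exact ⟨u, v, huv, P.edge_length u v (huv ▸ hF)⟩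

end ConvexUnitPolyhedron

/-! ### Paths on the surface and existence of shortest paths. -/

namespace ConvexUnitPolyhedron

variable (P : ConvexUnitPolyhedron)

/-- Some path on the surface from `x` to `y` has length at most `ℓ`. -/
def PathLE (x y : E3) (ℓ : ENNReal) : Prop :=
  ∃ η : ℝ → E3, P.IsSurfacePath x y η ∧ eVariationOn η (Icc 0 1) ≤ ℓ

variable {P}

lemma PathLE.trans {x y z : E3} {ℓ ℓ' : ENNReal} (h : P.PathLE x y ℓ) (h' : P.PathLE y z ℓ') :
    P.PathLE x z (ℓ + ℓ') := by
  obtain ⟨η, h1, h2⟩ := h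
  obtain ⟨η', h1', h2'⟩ := h'
  set ρ : ℝ → E3 := fun t => if t ≤ 1 / 2 then η (2 * t) else η' (2 * t - 1) with hρ
  have e1 : EqOn ρ (η ∘ fun t => 2 * t) (Icc 0 (1 / 2)) := fun t ht => by
    simp only [hρ, if_pos ht.2, Function.comp]
  have e2 : EqOn ρ (η' ∘ fun t => 2 * t - 1) (Icc (1 / 2) 1) := fun t ht => by
    rcases ht.1.eq_or_lt with h | h
    · subst h
      norm_num [hρ, h1.target, h1'.source]
    · simp only [hρ, if_neg (not_le.2 h), Function.comp]
  have m1 : MapsTo (fun t : ℝ => 2 * t) (Icc 0 (1 / 2)) (Icc 0 1) := fun t ht =>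
    ⟨by linarith [ht.1], by linarith [ht.2]⟩
  have m2 : MapsTo (fun t : ℝ => 2 * t - 1) (Icc (1 / 2) 1) (Icc 0 1) := fun t ht =>
    ⟨by linarith [ht.1], by linarith [ht.2]⟩
  have hu : Icc (0 : ℝ) 1 = Icc 0 (1 / 2) ∪ Icc (1 / 2) 1 :=
    (Icc_union_Icc_eq_Icc (by norm_num) (by norm_num)).symm
  refine ⟨ρ, ⟨?_, ?_, ?_, ?_⟩, ?_⟩
  · rw [hu]
    refine ContinuousOn.union_of_isClosed ?_ ?_ isClosed_Icc isClosed_Icc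
    · exact (h1.continuousOn.comp (by fun_prop) m1).congr e1
    · exact (h1'.continuousOn.comp (by fun_prop) m2).congr e2
  · intro t ht
    rw [hu] at ht
    rcases ht with ht | ht
    · rw [e1 ht]; exact h1.mem_surface _ (m1 ht)
    · rw [e2 ht]; exact h1'.mem_surface _ (m2 ht)
  · rw [e1 ⟨le_rfl, by norm_num⟩]
    simp [h1.source]
  · rw [e2 ⟨by norm_num, le_rfl⟩]
    norm_num [h1'.target]
  · have h3 := eVariationOn.Icc_add_Icc ρ (s := univ) (a := (0 : ℝ)) (b := 1 / 2) (c := 1)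
      (by norm_num) (by norm_num) (mem_univ _)
    simp only [univ_inter] at h3
    rw [← h3, eVariationOn.congr e1, eVariationOn.congr e2]
    refine add_le_add ((eVariationOn.comp_le_of_monotoneOn η _ ?_ m1).trans h2)
      ((eVariationOn.comp_le_of_monotoneOn η' _ ?_ m2).trans h2')
    · intro a _ b _ hab
      dsimp only
      linarith
    · intro a _ b _ hab
      dsimp only
      linarith

lemma IsSurfacePath.pathLE {p q : E3} {γ : ℝ → E3} (h : P.IsSurfacePath p q γ) {s t : ℝ}
    (hs : 0 ≤ s) (hst : s ≤ t) (ht : t ≤ 1) :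
    P.PathLE (γ s) (γ t) (eVariationOn γ (Icc s t)) := by
  have m : MapsTo (fun r : ℝ => s + (t - s) * r) (Icc 0 1) (Icc s t) := fun r hr =>
    ⟨by nlinarith [hr.1], by nlinarith [hr.2]⟩
  refine ⟨γ ∘ fun r => s + (t - s) * r, ⟨?_, ?_, by simp, by simp⟩, ?_⟩
  · exact (h.continuousOn.mono (Icc_subset_Icc hs ht)).comp (by fun_prop) m
  · intro r hr
    exact h.mem_surface _ (Icc_subset_Icc hs ht (m hr))
  · refine eVariationOn.comp_le_of_monotoneOn γ _ ?_ m
    intro a _ b _ hab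
    dsimp only
    nlinarith

lemma PathLE.of_lipschitzWith {f : E3 → E3} (hf : LipschitzWith 1 f) {x y : E3}
    (h : ∀ z ∈ segment ℝ x y, f z ∈ P.surface) : P.PathLE (f x) (f y) (edist x y) := by
  have hl : LipschitzWith (nndist x y) (AffineMap.lineMap x y : ℝ → E3) :=
    lipschitzWith_lineMap x y
  refine ⟨f ∘ AffineMap.lineMap x y, ⟨?_, ?_, by simp, by simp⟩, ?_⟩
  · exact (hf.continuous.comp AffineMap.lineMap_continuous).continuousOn
  · intro t ht
    refine h _ ?_
    rw [segment_eq_image_lineMap]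
    exact ⟨t, ht, rfl⟩
  · have h1 := (hf.comp hl).lipschitzOnWith (s := univ) |>.comp_eVariationOn_le (g := id)
      (s := Icc (0 : ℝ) 1) (mapsTo_univ _ _)
    rw [edist_nndist]
    simpa using h1

lemma PathLE.of_segment {x y : E3} (h : segment ℝ x y ⊆ P.surface) :
    P.PathLE x y (edist x y) :=
  PathLE.of_lipschitzWith (f := id) LipschitzWith.id h

lemma PathLE.of_mem_face {F : P.Face} {x y : E3} (hx : x ∈ F.pts) (hy : y ∈ F.pts) :
    P.PathLE x y (edist x y) :=
  PathLE.of_segment ((F.convex.segment_subset hx hy).trans F.subset_surface)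

variable (P)

/-- The nearest point is characterized by an obtuse angle; adding this condition for two points and
applying Cauchy–Schwarz gives the Lipschitz constant. For `x` outside the polyhedron, `x - f x` is
an outer normal at `f x`, which is therefore on the surface. -/
lemma exists_proj : ∃ f : E3 → E3, LipschitzWith 1 f ∧ (∀ x ∈ P.carrier, f x = x) ∧
    ∀ x ∉ interior P.carrier, f x ∈ P.surface := by
  have hne : P.carrier.Nonempty := P.interior_nonempty.mono interior_subset
  have h : ∀ x : E3, ∃ v ∈ P.carrier, ∀ w ∈ P.carrier, inner ℝ (x - v) (w - v) ≤ 0 := by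
    intro x
    obtain ⟨v, hv, h⟩ := exists_norm_eq_iInf_of_complete_convex hne
      P.isClosed_carrier.isComplete P.convex_carrier x
    exact ⟨v, hv, (norm_eq_iInf_iff_real_inner_le_zero P.convex_carrier hv).1 h⟩
  choose f hfK hf using h
  have hfix : ∀ x ∈ P.carrier, f x = x := by
    intro x hx
    have := hf x x hx
    rw [real_inner_self_nonpos, sub_eq_zero] at this
    exact this.symm
  refine ⟨f, ?_, hfix, ?_⟩
  · refine LipschitzWith.of_dist_le_mul fun x y => ?_
    have h1 := hf x (f y) (hfK y)
    have h2 := hf y (f x) (hfK x)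
    have h3 : inner ℝ (f x - f y) (f x - f y) ≤ inner ℝ (x - y) (f x - f y) := by
      have e1 : f y - f x = -(f x - f y) := by abel
      rw [e1, inner_neg_right] at h1
      have e2 : inner ℝ (x - y) (f x - f y) = inner ℝ (x - f x) (f x - f y) -
          inner ℝ (y - f y) (f x - f y) + inner ℝ (f x - f y) (f x - f y) := by
        rw [← inner_sub_left, ← inner_add_left]
        congr 1
        abel
      linarith
    have h4 := real_inner_le_norm (x - y) (f x - f y)
    rw [real_inner_self_eq_norm_sq] at h3
    rw [dist_eq_norm, dist_eq_norm, NNReal.coe_one, one_mul]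
    by_contra! h5
    nlinarith [norm_nonneg (x - y), norm_nonneg (f x - f y)]
  · intro x hx
    rw [surface_eq]
    refine ⟨hfK x, ?_⟩
    by_cases hxK : x ∈ P.carrier
    · rwa [hfix x hxK]
    have hne : x - f x ≠ 0 := fun h => hxK (by rw [sub_eq_zero.1 h]; exact hfK x)
    have hl : innerSL ℝ (x - f x) ≠ 0 := fun h => hne (by
      rw [← inner_self_eq_zero (𝕜 := ℝ), ← innerSL_apply_apply ℝ, h]; rfl)
    refine P.notMem_interior hl (c := inner ℝ (x - f x) (f x)) (fun y hy => ?_) le_rfl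
    have := hf x y hy
    rw [inner_sub_right] at this
    simp only [innerSL_apply_apply]
    linarith

/-- The nearest-point projection onto the polyhedron. -/
noncomputable def proj : E3 → E3 := P.exists_proj.choose

lemma lipschitzWith_proj : LipschitzWith 1 P.proj := P.exists_proj.choose_spec.1

lemma proj_eq {x : E3} (hx : x ∈ P.carrier) : P.proj x = x := P.exists_proj.choose_spec.2.1 x hx

lemma proj_mem {x : E3} (hx : x ∉ interior P.carrier) : P.proj x ∈ P.surface :=
  P.exists_proj.choose_spec.2.2 x hx

/-- A segment in a closed half-space beyond a supporting plane projects to a path on the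
surface. -/
lemma pathLE_proj {l : StrongDual ℝ E3} (hl : l ≠ 0) {c : ℝ} (hc : ∀ y ∈ P.carrier, l y ≤ c)
    {x y : E3} (hx : c ≤ l x) (hy : c ≤ l y) : P.PathLE (P.proj x) (P.proj y) (edist x y) := by
  refine PathLE.of_lipschitzWith P.lipschitzWith_proj fun z hz => P.proj_mem ?_
  refine P.notMem_interior hl hc ?_
  exact (convex_halfSpace_ge l.toLinearMap.isLinear c).segment_subset hx hy hz

/-- Applied to the normals of two faces, this gives a direction parallel to both. -/
lemma exists_common_ker (l l' : StrongDual ℝ E3) : ∃ d : E3, d ≠ 0 ∧ l d = 0 ∧ l' d = 0 := by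
  have h : LinearMap.ker (l.toLinearMap.prod l'.toLinearMap) ≠ ⊥ :=
    LinearMap.ker_ne_bot_of_finrank_lt (by simp)
  obtain ⟨d, hd, hd0⟩ := Submodule.exists_mem_ne_zero_of_ne_bot h
  rw [LinearMap.ker_prod] at hd
  exact ⟨d, hd0, hd.1, hd.2⟩

variable {P}

/-- Go from `p` far along `d` in the plane of `A`, across beyond a supporting plane orthogonal to
`d`, and back to `q` in the plane of `B`. This broken line avoids the interior and is projected. -/
lemma exists_surfacePath {p q : E3} (hp : p ∈ P.surface) (hq : q ∈ P.surface) :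
    ∃ γ, P.IsSurfacePath p q γ := by
  obtain ⟨A, hA⟩ := exists_face_of_mem_surface hp
  obtain ⟨B, hB⟩ := exists_face_of_mem_surface hq
  obtain ⟨d, hd0, hdA, hdB⟩ := exists_common_ker A.normal B.normal
  obtain ⟨c, hc⟩ := P.isCompact_carrier.bddAbove_image
    (f := innerSL ℝ d) (innerSL ℝ d).continuous.continuousOn
  have hc' : ∀ y ∈ P.carrier, innerSL ℝ d y ≤ c := fun y hy => hc ⟨y, hy, rfl⟩
  have hl : innerSL ℝ d ≠ 0 := fun h => hd0 (by
    rw [← inner_self_eq_zero (𝕜 := ℝ), ← innerSL_apply_apply ℝ, h]; rfl)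
  have hdd : 0 < inner ℝ d d := by rwa [real_inner_self_pos]
  obtain ⟨R, hRp, hRq⟩ : ∃ R : ℝ, c ≤ innerSL ℝ d (p + R • d) ∧ c ≤ innerSL ℝ d (q + R • d) := by
    refine ⟨max ((c - inner ℝ d p) / inner ℝ d d) ((c - inner ℝ d q) / inner ℝ d d), ?_, ?_⟩
    · have := le_max_left ((c - inner ℝ d p) / inner ℝ d d) ((c - inner ℝ d q) / inner ℝ d d)
      rw [div_le_iff₀ hdd] at this
      simp only [map_add, map_smul, innerSL_apply_apply, smul_eq_mul]
      linarith
    · have := le_max_right ((c - inner ℝ d p) / inner ℝ d d) ((c - inner ℝ d q) / inner ℝ d d)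
      rw [div_le_iff₀ hdd] at this
      simp only [map_add, map_smul, innerSL_apply_apply, smul_eq_mul]
      linarith
  have h1 := P.pathLE_proj A.normal_ne_zero (fun _ => Face.normal_le) (x := p) (y := p + R • d)
    (Face.normal_eq hA).ge (by simp [hdA, Face.normal_eq hA])
  have h2 := P.pathLE_proj hl hc' hRp hRq
  have h3 := P.pathLE_proj B.normal_ne_zero (fun _ => Face.normal_le) (x := q + R • d) (y := q)
    (by simp [hdB, Face.normal_eq hB]) (Face.normal_eq hB).ge
  rw [P.proj_eq (P.surface_subset hp)] at h1
  rw [P.proj_eq (P.surface_subset hq)] at h3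
  obtain ⟨γ, hγ, -⟩ := (h1.trans h2).trans h3
  exact ⟨γ, hγ⟩

/-- A path on the surface is not shorter than some polygonal path whose sides lie in faces; the
number of sides is bounded by the number of faces. -/
lemma IsSurfacePath.exists_chain {p q : E3} {γ : ℝ → E3} (h : P.IsSurfacePath p q γ) (n : ℕ) :
    ∀ 𝒜 : Finset P.Face, 𝒜.card ≤ n → ∀ t ∈ Icc (0 : ℝ) 1,
      (∀ r ∈ Icc t 1, ∃ F ∈ 𝒜, γ r ∈ F.pts) →
      ∃ x : ℕ → E3, x 0 = γ t ∧ (∀ i ≥ n, x i = q) ∧ (∀ i, ∃ F : P.Face, x i ∈ F.pts ∧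
        x (i + 1) ∈ F.pts) ∧
        ∑ i ∈ Finset.range n, edist (x i) (x (i + 1)) ≤ eVariationOn γ (Icc t 1) := by
  classical
  induction n with
  | zero =>
    intro 𝒜 h𝒜 t ht hc
    obtain ⟨F, hF, -⟩ := hc t ⟨le_rfl, ht.2⟩
    simp [Finset.card_eq_zero.1 (Nat.le_zero.1 h𝒜)] at hF
  | succ n ih =>
    intro 𝒜 h𝒜 t ht hc
    obtain ⟨F, hF, htF⟩ := hc t ⟨le_rfl, ht.2⟩
    have hcomp : IsCompact (Icc t 1 ∩ γ ⁻¹' F.pts) :=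
      isCompact_Icc.of_isClosed_subset ((h.continuousOn.mono
        (Icc_subset_Icc ht.1 le_rfl)).preimage_isClosed_of_isClosed
        isClosed_Icc F.isCompact.isClosed) inter_subset_left
    -- After its last time `t'` in `F` the path stays in the other faces of `𝒜`, and by closedness
    -- it is in one of them at `t'` too. So `F` can be erased, and the chord from `γ t` to `γ t'` is
    -- the first side.
    obtain ⟨t', ⟨ht', ht'F⟩, hmax⟩ := hcomp.exists_isGreatest ⟨t, ⟨le_rfl, ht.2⟩, htF⟩
    have ht'0 : t' ∈ Icc (0 : ℝ) 1 := ⟨ht.1.trans ht'.1, ht'.2⟩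
    obtain ⟨x, hx0, hxn, hxF, hxs⟩ : ∃ x : ℕ → E3, x 0 = γ t' ∧ (∀ i ≥ n, x i = q) ∧
        (∀ i, ∃ F : P.Face, x i ∈ F.pts ∧ x (i + 1) ∈ F.pts) ∧
        ∑ i ∈ Finset.range n, edist (x i) (x (i + 1)) ≤ eVariationOn γ (Icc t' 1) := by
      rcases ht'.2.eq_or_lt with h1 | h1
      · subst h1
        refine ⟨fun _ => q, h.target.symm, fun _ _ => rfl, fun _ => ⟨F, ?_, ?_⟩, by simp⟩ <;>
        · rw [← h.target]; exact ht'F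
      refine ih (𝒜.erase F) ?_ t' ht'0 ?_
      · rw [Finset.card_erase_of_mem hF]; omega
      · have hcl : IsClosed (Icc t' 1 ∩ γ ⁻¹' (⋃ G ∈ 𝒜.erase F, G.pts)) := by
          refine (h.continuousOn.mono (Icc_subset_Icc ht'0.1 le_rfl)).preimage_isClosed_of_isClosed
            isClosed_Icc ?_
          exact isClosed_biUnion_finset fun G _ => G.isCompact.isClosed
        have hsub : Ioc t' 1 ⊆ Icc t' 1 ∩ γ ⁻¹' (⋃ G ∈ 𝒜.erase F, G.pts) := by
          intro r hr
          refine ⟨Ioc_subset_Icc_self hr, ?_⟩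
          obtain ⟨G, hG, hrG⟩ := hc r ⟨ht'.1.trans hr.1.le, hr.2⟩
          have hGF : G ≠ F := by
            rintro rfl
            exact absurd (hmax ⟨⟨ht'.1.trans hr.1.le, hr.2⟩, hrG⟩) (not_le.2 hr.1)
          simp only [mem_preimage, mem_iUnion]
          exact ⟨G, Finset.mem_erase.2 ⟨hGF, hG⟩, hrG⟩
        have hcl2 := closure_minimal hsub hcl
        rw [closure_Ioc h1.ne] at hcl2
        intro r hr
        have := (hcl2 hr).2
        simp only [mem_preimage, mem_iUnion] at this
        obtain ⟨G, hG, hrG⟩ := this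
        exact ⟨G, hG, hrG⟩
    refine ⟨fun i => Nat.casesOn i (γ t) x, rfl, ?_, ?_, ?_⟩
    · rintro (_ | i) hi
      · omega
      · exact hxn i (by omega)
    · rintro (_ | i)
      · exact ⟨F, htF, by simpa [hx0] using ht'F⟩
      · exact hxF i
    · rw [Finset.sum_range_succ']
      have h3 := eVariationOn.Icc_add_Icc γ (s := univ) ht'.1 ht'.2 (mem_univ _)
      simp only [univ_inter] at h3
      rw [← h3, add_comm]
      refine add_le_add ?_ hxs
      simp only [hx0]
      exact eVariationOn.edist_le γ ⟨le_rfl, ht'.1⟩ ⟨ht'.1, le_rfl⟩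

lemma pathLE_of_chain {x : ℕ → E3} (hx : ∀ i, ∃ F : P.Face, x i ∈ F.pts ∧ x (i + 1) ∈ F.pts)
    (n : ℕ) : P.PathLE (x 0) (x n) (∑ i ∈ Finset.range n, edist (x i) (x (i + 1))) := by
  induction n with
  | zero =>
    obtain ⟨F, h, -⟩ := hx 0
    simpa using PathLE.of_mem_face h h
  | succ n ih =>
    obtain ⟨F, h, h'⟩ := hx n
    rw [Finset.sum_range_succ]
    exact ih.trans (PathLE.of_mem_face h h')

/-- Any two points of the surface are joined by a shortest path. -/
theorem exists_isShortestPath {p q : E3} (hp : p ∈ P.surface) (hq : q ∈ P.surface) :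
    ∃ γ, P.IsShortestPath p q γ := by
  classical
  have := Fintype.ofFinite P.Face
  set N := (Finset.univ : Finset P.Face).card
  -- The terms after the `N`-th are kept on faces as well, so that `C` is closed in a compact
  -- product.
  set C : Set (ℕ → E3) := {x | x 0 = p ∧ x N = q ∧
    ∀ i, ∃ F : P.Face, x i ∈ F.pts ∧ x (i + 1) ∈ F.pts} with hC
  have hchain : ∀ γ, P.IsSurfacePath p q γ → ∃ x ∈ C,
      ∑ i ∈ Finset.range N, edist (x i) (x (i + 1)) ≤ eVariationOn γ (Icc 0 1) := by
    intro γ hγ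
    obtain ⟨x, h1, h2, h3, h4⟩ := hγ.exists_chain N Finset.univ le_rfl 0 ⟨le_rfl, zero_le_one⟩
      fun r hr => by simpa using exists_face_of_mem_surface (hγ.mem_surface r hr)
    exact ⟨x, ⟨h1.trans hγ.source, h2 N le_rfl, h3⟩, h4⟩
  have hCc : IsCompact C := by
    refine (isCompact_univ_pi fun _ => P.isCompact_surface).of_isClosed_subset ?_ ?_
    · have e : C = {x | x 0 = p} ∩ ({x | x N = q} ∩
          ⋂ i, ⋃ F : P.Face, {x | x i ∈ F.pts} ∩ {x | x (i + 1) ∈ F.pts}) := by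
        ext x; simp [hC]
      rw [e]
      refine (isClosed_eq (continuous_apply _) continuous_const).inter
        ((isClosed_eq (continuous_apply _) continuous_const).inter (isClosed_iInter fun i =>
          isClosed_iUnion_of_finite fun F => ?_))
      exact (F.isCompact.isClosed.preimage (continuous_apply i)).inter
        (F.isCompact.isClosed.preimage (continuous_apply (i + 1)))
    · intro x hx i _
      obtain ⟨F, hF, -⟩ := hx.2.2 i
      exact F.subset_surface hF
  have hCne : C.Nonempty := by
    obtain ⟨γ, hγ⟩ := exists_surfacePath hp hq
    obtain ⟨x, hx, -⟩ := hchain γ hγ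
    exact ⟨x, hx⟩
  have hcont : Continuous fun x : ℕ → E3 => ∑ i ∈ Finset.range N, edist (x i) (x (i + 1)) :=
    continuous_finsetSum _ fun i _ => (continuous_apply _).edist (continuous_apply _)
  obtain ⟨x, hx, hmin⟩ := hCc.exists_isMinOn hCne hcont.continuousOn
  have hx' := pathLE_of_chain hx.2.2 N
  rw [hx.1, hx.2.1] at hx'
  obtain ⟨γ, hγ, hle⟩ := hx'
  refine ⟨γ, hγ, fun η hη => ?_⟩
  obtain ⟨y, hy, hyη⟩ := hchain η hη
  exact hle.trans ((hmin hy).trans hyη)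

/-! ### Parts of a shortest path. -/

section Shortest

variable {p q : E3} {γ : ℝ → E3}

lemma eVariationOn_split {f : ℝ → E3} {a b c : ℝ} (hab : a ≤ b) (hbc : b ≤ c) :
    eVariationOn f (Icc a b) + eVariationOn f (Icc b c) = eVariationOn f (Icc a c) := by
  simpa using eVariationOn.Icc_add_Icc f (s := univ) hab hbc (mem_univ _)

namespace IsShortestPath

lemma variation_ne_top (h : P.IsShortestPath p q γ) : eVariationOn γ (Icc 0 1) ≠ ⊤ := by
  classical
  have := Fintype.ofFinite P.Face
  obtain ⟨x, h1, h2, h3, -⟩ := h.1.exists_chain _ Finset.univ le_rfl 0 ⟨le_rfl, zero_le_one⟩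
      fun r hr => by simpa using exists_face_of_mem_surface (h.1.mem_surface r hr)
  have h4 := pathLE_of_chain h3 (Finset.univ : Finset P.Face).card
  rw [h1, h2 _ le_rfl, h.1.source] at h4
  obtain ⟨η, hη, hle⟩ := h4
  refine ne_top_of_le_ne_top ?_ ((h.2 η hη).trans hle)
  exact ENNReal.sum_ne_top.2 fun i _ => edist_ne_top _ _

/-- The parts of a shortest path are shortest. -/
lemma variation_le (h : P.IsShortestPath p q γ) {s t : ℝ} (hs : 0 ≤ s) (hst : s ≤ t) (ht : t ≤ 1)
    {ℓ : ENNReal} (hℓ : P.PathLE (γ s) (γ t) ℓ) : eVariationOn γ (Icc s t) ≤ ℓ := by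
  have h1 := h.1.pathLE le_rfl hs (hst.trans ht)
  have h2 := h.1.pathLE (hs.trans hst) ht le_rfl
  rw [h.1.source] at h1
  rw [h.1.target] at h2
  obtain ⟨η, hη, hle⟩ := (h1.trans hℓ).trans h2
  have h3 := (h.2 η hη).trans hle
  have h4 := h.variation_ne_top
  rw [← eVariationOn_split (hs.trans hst) ht, ← eVariationOn_split hs hst] at h3 h4
  rw [ENNReal.add_le_add_iff_right (by finiteness [(ENNReal.add_ne_top.1 h4).2])] at h3
  rwa [ENNReal.add_le_add_iff_left (ENNReal.add_ne_top.1 (ENNReal.add_ne_top.1 h4).1).1] at h3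

lemma variation_eq (h : P.IsShortestPath p q γ) {s t : ℝ} (hs : 0 ≤ s) (hst : s ≤ t) (ht : t ≤ 1)
    {F : P.Face} (hsF : γ s ∈ F.pts) (htF : γ t ∈ F.pts) :
    eVariationOn γ (Icc s t) = edist (γ s) (γ t) :=
  le_antisymm (h.variation_le hs hst ht (PathLE.of_mem_face hsF htF))
    (eVariationOn.edist_le γ ⟨le_rfl, hst⟩ ⟨hst, le_rfl⟩)

/-- The chord between two points of a face is a competitor, so the length equals the distance and
the triangle inequality is an equality at every intermediate point. -/
lemma wbtw (h : P.IsShortestPath p q γ) {s r t : ℝ} (hs : 0 ≤ s) (hsr : s ≤ r) (hrt : r ≤ t)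
    (ht : t ≤ 1) {F : P.Face} (hsF : γ s ∈ F.pts) (htF : γ t ∈ F.pts) :
    Wbtw ℝ (γ s) (γ r) (γ t) := by
  rw [← dist_add_dist_eq_iff]
  refine le_antisymm ?_ (dist_triangle _ _ _)
  have h1 := h.variation_eq hs (hsr.trans hrt) ht hsF htF
  rw [← eVariationOn_split hsr hrt] at h1
  have h2 := add_le_add (eVariationOn.edist_le γ (s := Icc s r) ⟨le_rfl, hsr⟩ ⟨hsr, le_rfl⟩)
    (eVariationOn.edist_le γ (s := Icc r t) ⟨le_rfl, hrt⟩ ⟨hrt, le_rfl⟩)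
  rw [h1, edist_dist, edist_dist, edist_dist, ← ENNReal.ofReal_add dist_nonneg dist_nonneg,
    ENNReal.ofReal_le_ofReal_iff dist_nonneg] at h2
  exact h2

/-- A shortest path meets each face in a connected set of times. -/
lemma mem_of_mem_of_mem (h : P.IsShortestPath p q γ) {s r t : ℝ} (hs : 0 ≤ s) (hsr : s ≤ r)
    (hrt : r ≤ t) (ht : t ≤ 1) {F : P.Face} (hsF : γ s ∈ F.pts) (htF : γ t ∈ F.pts) :
    γ r ∈ F.pts :=
  F.convex.segment_subset hsF htF (mem_segment_iff_wbtw.2 (h.wbtw hs hsr hrt ht hsF htF))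

end IsShortestPath

end Shortest

end ConvexUnitPolyhedron

/-! ### First variation at edges and vertices. -/

namespace ConvexUnitPolyhedron

variable (P : ConvexUnitPolyhedron)

/-- The broken line from `a` through `v` to `b` is not longer than any path on the surface from
`a` to `b`. -/
def IsGeodesicAt (a v b : E3) : Prop := ∀ ℓ, P.PathLE a b ℓ → edist a v + edist v b ≤ ℓ

/-- The unit vector in the direction from `v` to `a`. -/
noncomputable def dir (v a : E3) : E3 := (dist a v)⁻¹ • (a - v)

variable {P}

lemma norm_dir {v a : E3} (h : a ≠ v) : ‖dir v a‖ = 1 := by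
  rw [dir, norm_smul, norm_inv, Real.norm_of_nonneg dist_nonneg, dist_eq_norm,
    inv_mul_cancel₀ (norm_ne_zero_iff.2 (sub_ne_zero.2 h))]

lemma dist_smul_dir {v a : E3} (h : a ≠ v) : dist a v • dir v a = a - v := by
  rw [dir, smul_smul, mul_inv_cancel₀ (dist_ne_zero.2 h), one_smul]

lemma add_smul_dir_mem {F : P.Face} {v a : E3} (ha : a ∈ F.pts) (hv : v ∈ F.pts) (h : a ≠ v)
    {r : ℝ} (hr0 : 0 ≤ r) (hr : r ≤ dist a v) : v + r • dir v a ∈ F.pts := by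
  have hd : 0 < dist a v := dist_pos.2 h
  have := F.convex.add_smul_sub_mem hv ha (t := r / dist a v)
    ⟨by positivity, (div_le_one hd).2 hr⟩
  rwa [dir, smul_smul, ← div_eq_mul_inv]

lemma Face.normal_dir {F : P.Face} {v a : E3} (ha : a ∈ F.pts) (hv : v ∈ F.pts) :
    F.normal (dir v a) = 0 := by
  rw [dir, map_smul, map_sub, Face.normal_eq ha, Face.normal_eq hv, sub_self, smul_zero]

lemma dist_add_smul_dir {v a : E3} (h : a ≠ v) {r : ℝ} (hr0 : 0 ≤ r) :
    dist (v + r • dir v a) v = r := by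
  rw [dist_eq_norm, add_sub_cancel_left, norm_smul, norm_dir h, Real.norm_of_nonneg hr0, mul_one]

lemma dist_add_smul_dir' {v a : E3} (h : a ≠ v) {r : ℝ} (hr : r ≤ dist a v) :
    dist a (v + r • dir v a) = dist a v - r := by
  rw [dist_eq_norm, ← sub_sub, ← dist_smul_dir h, ← sub_smul, norm_smul, norm_dir h,
    Real.norm_of_nonneg (by linarith), mul_one]

lemma IsGeodesicAt.le {a v b : E3} (h : P.IsGeodesicAt a v b) {ℓ : ℝ} (hℓ0 : 0 ≤ ℓ)
    (hℓ : P.PathLE a b (ENNReal.ofReal ℓ)) : dist a v + dist v b ≤ ℓ := by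
  have := h _ hℓ
  rwa [edist_dist, edist_dist, ← ENNReal.ofReal_add dist_nonneg dist_nonneg,
    ENNReal.ofReal_le_ofReal_iff hℓ0] at this

/-- The first variation estimate for the length of a shortest broken line. -/
lemma IsGeodesicAt.first_variation {A B : P.Face} {a v b : E3} (h : P.IsGeodesicAt a v b)
    (haA : a ∈ A.pts) (hvA : v ∈ A.pts) (hvB : v ∈ B.pts) (hbB : b ∈ B.pts)
    (hav : a ≠ v) (hbv : b ≠ v) {l : StrongDual ℝ E3} (hl0 : l ≠ 0)
    (hl : ∀ y ∈ P.carrier, l y ≤ l v) {ξ η : E3} (hξA : 0 ≤ A.normal ξ) (hηB : 0 ≤ B.normal η)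
    (hξl : 0 ≤ l ξ) (hηl : 0 ≤ l η) :
    inner ℝ ξ (dir v a) + inner ℝ η (dir v b) ≤ ‖ξ - η‖ := by
  set α := dir v a with hα
  set β := dir v b with hβ
  obtain ⟨r, hr0, hra, hrb⟩ : ∃ r : ℝ, 0 < r ∧ r ≤ dist a v ∧ r ≤ dist b v :=
    ⟨min (dist a v) (dist b v), lt_min (dist_pos.2 hav) (dist_pos.2 hbv), min_le_left _ _,
      min_le_right _ _⟩
  have ha' : v + r • α ∈ A.pts := add_smul_dir_mem haA hvA hav hr0.le hra
  have hb' : v + r • β ∈ B.pts := add_smul_dir_mem hbB hvB hbv hr0.le hrb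
  -- From `2 * r * y ≤ y ^ 2 + r ^ 2`: a first-order expansion of the norm with an explicit
  -- quadratic error.
  have norm_le : ∀ (ω ζ : E3) (ε : ℝ), ‖ω‖ = 1 →
      ‖r • ω - ε • ζ‖ ≤ r - ε * inner ℝ ζ ω + ε ^ 2 * ‖ζ‖ ^ 2 / (2 * r) := by
    intro ω ζ ε hω
    have h1 : ‖r • ω - ε • ζ‖ ^ 2 = r ^ 2 - 2 * r * ε * inner ℝ ζ ω + ε ^ 2 * ‖ζ‖ ^ 2 := by
      rw [norm_sub_sq_real, norm_smul, norm_smul, mul_pow, mul_pow, hω, real_inner_smul_left,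
        real_inner_smul_right, real_inner_comm, Real.norm_eq_abs, Real.norm_eq_abs, sq_abs, sq_abs]
      ring
    have h2 := sq_nonneg (‖r • ω - ε • ζ‖ - r)
    have h3 : r - ε * inner ℝ ζ ω + ε ^ 2 * ‖ζ‖ ^ 2 / (2 * r) =
        (‖r • ω - ε • ζ‖ ^ 2 + r ^ 2) / (2 * r) := by
      rw [h1]; field_simp; ring
    rw [h3, le_div_iff₀ (by positivity)]
    linarith
  -- The competitor is the projection of the broken line through `a`, `v + r • α`, `v + ε • ξ`, `v +
  -- ε • η`, `v + r • β`, `b`. Its three middle sides lie beyond the supporting planes given by `A`,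
  -- `l` and `B`.
  have key : ∀ ε : ℝ, 0 < ε → inner ℝ ξ α + inner ℝ η β ≤
      ‖ξ - η‖ + ε * ((‖ξ‖ ^ 2 + ‖η‖ ^ 2) / (2 * r)) := by
    intro ε hε
    have p1 : P.PathLE a (v + r • α) (ENNReal.ofReal (dist a (v + r • α))) := by
      rw [← edist_dist]; exact PathLE.of_mem_face haA ha'
    have p2 := P.pathLE_proj A.normal_ne_zero (fun _ => Face.normal_le) (x := v + r • α)
      (y := v + ε • ξ) (Face.normal_eq ha').ge
      (by simp only [map_add, map_smul, smul_eq_mul, Face.normal_eq hvA]; nlinarith)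
    have p3 := P.pathLE_proj hl0 hl (x := v + ε • ξ) (y := v + ε • η)
      (by simp only [map_add, map_smul, smul_eq_mul]; nlinarith)
      (by simp only [map_add, map_smul, smul_eq_mul]; nlinarith)
    have p4 := P.pathLE_proj B.normal_ne_zero (fun _ => Face.normal_le) (x := v + ε • η)
      (y := v + r • β)
      (by simp only [map_add, map_smul, smul_eq_mul, Face.normal_eq hvB]; nlinarith)
      (Face.normal_eq hb').ge
    have p5 := PathLE.of_mem_face hb' hbB
    rw [P.proj_eq (A.subset_carrier ha')] at p2
    rw [P.proj_eq (B.subset_carrier hb')] at p4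
    have p := (((p1.trans (p2.trans p3)).trans p4).trans p5)
    rw [edist_dist, edist_dist, edist_dist, edist_dist, ← ENNReal.ofReal_add (by positivity)
      (by positivity), ← ENNReal.ofReal_add (by positivity) (by positivity),
      ← ENNReal.ofReal_add (by positivity) (by positivity),
      ← ENNReal.ofReal_add (by positivity) (by positivity)] at p
    have h1 := h.le (by positivity) p
    rw [dist_add_smul_dir' hav hra, dist_comm (v + r • β) b, dist_add_smul_dir' hbv hrb, dist_comm v b,
      dist_eq_norm (v + r • α), dist_eq_norm (v + ε • ξ), dist_eq_norm (v + ε • η),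
      add_sub_add_left_eq_sub, add_sub_add_left_eq_sub, add_sub_add_left_eq_sub, ← smul_sub,
      norm_smul, Real.norm_of_nonneg hε.le, norm_sub_rev (ε • η)] at h1
    have h2 := norm_le α ξ ε (norm_dir hav)
    have h3 := norm_le β η ε (norm_dir hbv)
    have h4 : ε * (inner ℝ ξ α + inner ℝ η β) ≤
        ε * (‖ξ - η‖ + ε * ((‖ξ‖ ^ 2 + ‖η‖ ^ 2) / (2 * r))) := by
      have e : ε * (ε * ((‖ξ‖ ^ 2 + ‖η‖ ^ 2) / (2 * r))) =
        ε ^ 2 * ‖ξ‖ ^ 2 / (2 * r) + ε ^ 2 * ‖η‖ ^ 2 / (2 * r) := by ring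
      rw [mul_add, mul_add, e]
      linarith
    exact le_of_mul_le_mul_left h4 hε
  have hc : 0 ≤ (‖ξ‖ ^ 2 + ‖η‖ ^ 2) / (2 * r) := by positivity
  refine le_of_forall_pos_le_add fun δ hδ => ?_
  have h1 := key (δ / ((‖ξ‖ ^ 2 + ‖η‖ ^ 2) / (2 * r) + 1)) (by positivity)
  refine h1.trans (add_le_add le_rfl ?_)
  rw [div_mul_eq_mul_div, div_le_iff₀ (by positivity)]
  nlinarith

/-- A shortest broken line crosses an edge at equal angles. -/
lemma IsGeodesicAt.inner_eq_zero {A B : P.Face} {a v b : E3} (h : P.IsGeodesicAt a v b)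
    (haA : a ∈ A.pts) (hvA : v ∈ A.pts) (hvB : v ∈ B.pts) (hbB : b ∈ B.pts)
    (hav : a ≠ v) (hbv : b ≠ v) {d : E3} (hA : A.normal d = 0) (hB : B.normal d = 0) :
    inner ℝ d (dir v a) + inner ℝ d (dir v b) = 0 := by
  have hsupp : ∀ y ∈ P.carrier, A.normal y ≤ A.normal v := fun y hy => by
    rw [Face.normal_eq hvA]; exact Face.normal_le hy
  -- With `ξ = η` the right-hand side is zero; the choices `d` and `-d` bound the sum from both
  -- sides.
  have h1 := h.first_variation haA hvA hvB hbB hav hbv A.normal_ne_zero hsupp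
    hA.ge hB.ge hA.ge hA.ge
  have h2 := h.first_variation haA hvA hvB hbB hav hbv A.normal_ne_zero hsupp
    (ξ := -d) (η := -d) (by simp [hA]) (by simp [hB]) (by simp [hA]) (by simp [hA])
  simp only [sub_self, norm_zero, inner_neg_left] at h1 h2
  linarith

/-- A shortest broken line does not bend at a vertex. -/
lemma IsGeodesicAt.notMem_exposedPoints {A B : P.Face} {a v b : E3} (h : P.IsGeodesicAt a v b)
    (haA : a ∈ A.pts) (hvA : v ∈ A.pts) (hvB : v ∈ B.pts) (hbB : b ∈ B.pts)
    (hav : a ≠ v) (hbv : b ≠ v) : v ∉ P.carrier.exposedPoints ℝ := by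
  intro hv
  obtain ⟨d, l, hAd, hBd, hl0, hl, hld⟩ : ∃ d : E3, ∃ l : StrongDual ℝ E3, A.normal d = 0 ∧
      B.normal d = 0 ∧ l ≠ 0 ∧ (∀ y ∈ P.carrier, l y ≤ l v) ∧ 0 < l d := by
    obtain ⟨d, hd, hAd, hBd⟩ := exists_common_ker A.normal B.normal
    obtain ⟨l, hl0, hl, hld⟩ := exists_supporting_of_exposed hv hd
    rcases hld.lt_or_gt with h | h
    · exact ⟨-d, l, by simp [hAd], by simp [hBd], hl0, hl, by simpa using h⟩
    · exact ⟨d, l, hAd, hBd, hl0, hl, h⟩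
  set α := dir v a with hα
  set β := dir v b with hβ
  have hα1 : ‖α‖ = 1 := norm_dir hav
  have hβ1 : ‖β‖ = 1 := norm_dir hbv
  have h0 : inner ℝ d α + inner ℝ d β = 0 :=
    h.inner_eq_zero haA hvA hvB hbB hav hbv hAd hBd
  -- `δ` is small enough that `δ * |l α|` and `δ * |l β|` are at most `l d`.
  obtain ⟨δ, hδ, hδα, hδβ⟩ : ∃ δ : ℝ, 0 < δ ∧ 0 ≤ l d + δ * l α ∧ 0 ≤ l d + δ * l β := by
    refine ⟨l d / (|l α| + |l β| + 1), by positivity, ?_, ?_⟩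
    · rw [div_mul_eq_mul_div, ← neg_le_iff_add_nonneg, ← neg_div, div_le_iff₀ (by positivity)]
      nlinarith [mul_nonneg hld.le (by linarith [neg_abs_le (l α)] : 0 ≤ |l α| + l α),
        mul_nonneg hld.le (abs_nonneg (l β))]
    · rw [div_mul_eq_mul_div, ← neg_le_iff_add_nonneg, ← neg_div, div_le_iff₀ (by positivity)]
      nlinarith [mul_nonneg hld.le (by linarith [neg_abs_le (l β)] : 0 ≤ |l β| + l β),
        mul_nonneg hld.le (abs_nonneg (l α))]
  -- The terms in `d` cancel by `h0`, leaving `2 * δ ≤ δ * ‖α - β‖`, which forces `β = -α` for unit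
  -- vectors. Then `v` lies strictly between `a` and `b`, impossible for an exposed point.
  have h1 := h.first_variation haA hvA hvB hbB hav hbv hl0 hl (ξ := d + δ • α) (η := d + δ • β)
    (by simp [hAd, hα, Face.normal_dir haA hvA]) (by simp [hBd, hβ, Face.normal_dir hbB hvB])
    (by simpa using hδα) (by simpa using hδβ)
  rw [← hα, ← hβ, add_sub_add_left_eq_sub, ← smul_sub, norm_smul, Real.norm_of_nonneg hδ.le,
    inner_add_left, inner_add_left, real_inner_smul_left, real_inner_smul_left,
    real_inner_self_eq_norm_sq, real_inner_self_eq_norm_sq, hα1, hβ1] at h1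
  have h2 : 2 ≤ ‖α - β‖ := by
    refine le_of_mul_le_mul_left ?_ hδ
    linarith
  have h3 := norm_sub_sq_real α β
  have h4 := norm_add_sq_real α β
  rw [hα1, hβ1] at h3 h4
  have h5 : ‖α + β‖ = 0 := by
    have : ‖α + β‖ ^ 2 ≤ 0 := by nlinarith
    nlinarith [norm_nonneg (α + β)]
  rw [norm_eq_zero] at h5
  obtain ⟨-, f, hf⟩ := hv
  have ha := hf a (A.subset_carrier haA)
  have hb := hf b (B.subset_carrier hbB)
  have fa : f a - f v = dist a v * f α := by rw [← map_sub, ← dist_smul_dir hav]; simp [hα]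
  have fb : f b - f v = dist b v * f β := by rw [← map_sub, ← dist_smul_dir hbv]; simp [hβ]
  have fab : f α + f β = 0 := by rw [← map_add, h5, map_zero]
  have da := dist_pos.2 hav
  have db := dist_pos.2 hbv
  have hfβ : f β ≤ 0 := by
    by_contra! h
    nlinarith [mul_pos db h]
  apply hav
  apply ha.2
  nlinarith

section Germs

variable {p q : E3} {γ : ℝ → E3}

lemma IsSurfacePath.reverse (h : P.IsSurfacePath p q γ) :
    P.IsSurfacePath q p (fun t => γ (1 - t)) := by
  have m : MapsTo (fun t : ℝ => 1 - t) (Icc 0 1) (Icc 0 1) := fun t ht =>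
    ⟨by linarith [ht.2], by linarith [ht.1]⟩
  exact ⟨h.continuousOn.comp (by fun_prop) m, fun t ht => h.mem_surface _ (m ht),
    by simp [h.target], by simp [h.source]⟩

/-- A path on the surface meets, at times arbitrarily close after `t`, a face containing its point
at time `t`. -/
lemma IsSurfacePath.exists_face_right (h : P.IsSurfacePath p q γ) {t : ℝ} (ht0 : 0 ≤ t)
    (ht1 : t < 1) : ∃ (F : P.Face) (r : ℝ), t < r ∧ r ≤ 1 ∧ γ t ∈ F.pts ∧ γ r ∈ F.pts := by
  by_contra! hno
  have hcl : IsClosed (Icc t 1 ∩ γ ⁻¹' (⋃ F ∈ {F : P.Face | γ t ∉ F.pts}, F.pts)) := by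
    refine (h.continuousOn.mono (Icc_subset_Icc ht0 le_rfl)).preimage_isClosed_of_isClosed
      isClosed_Icc ?_
    exact (toFinite _).isClosed_biUnion fun F _ => F.isCompact.isClosed
  have hsub : Ioc t 1 ⊆ Icc t 1 ∩ γ ⁻¹' (⋃ F ∈ {F : P.Face | γ t ∉ F.pts}, F.pts) := by
    intro r hr
    obtain ⟨F, hF⟩ := exists_face_of_mem_surface (h.mem_surface r ⟨ht0.trans hr.1.le, hr.2⟩)
    refine ⟨Ioc_subset_Icc_self hr, ?_⟩
    simp only [mem_preimage, mem_iUnion]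
    exact ⟨F, fun h => hno F r hr.1 hr.2 h hF, hF⟩
  have := closure_minimal hsub hcl
  rw [closure_Ioc ht1.ne] at this
  have := (this ⟨le_rfl, ht1.le⟩).2
  simp only [mem_preimage, mem_iUnion] at this
  obtain ⟨F, hF, hF'⟩ := this
  exact hF hF'

lemma IsSurfacePath.exists_face_right_ne (h : P.IsSurfacePath p q γ) {t : ℝ} (ht0 : 0 ≤ t)
    (ht1 : t ≤ 1) (hq : γ t ≠ q) : ∃ (F : P.Face) (r : ℝ), t ≤ r ∧ r ≤ 1 ∧ γ t ∈ F.pts ∧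
      γ r ∈ F.pts ∧ γ r ≠ γ t := by
  -- The path may rest at `γ t` or come back to it, so the search starts at the last time spent
  -- there.
  have hcomp : IsCompact (Icc t 1 ∩ γ ⁻¹' {γ t}) :=
    isCompact_Icc.of_isClosed_subset ((h.continuousOn.mono
      (Icc_subset_Icc ht0 le_rfl)).preimage_isClosed_of_isClosed
        isClosed_Icc isClosed_singleton) inter_subset_left
  obtain ⟨t', ⟨ht', ht'v⟩, hmax⟩ := hcomp.exists_isGreatest ⟨t, ⟨le_rfl, ht1⟩, rfl⟩
  have ht'v : γ t' = γ t := ht'v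
  have ht'1 : t' < 1 := ht'.2.lt_of_ne fun h1 => hq (by rw [← ht'v, h1, h.target])
  obtain ⟨F, r, h1, h2, h3, h4⟩ := h.exists_face_right (ht0.trans ht'.1) ht'1
  refine ⟨F, r, ht'.1.trans h1.le, h2, ht'v ▸ h3, h4, fun h5 => ?_⟩
  exact absurd (hmax ⟨⟨ht'.1.trans h1.le, h2⟩, h5⟩) (not_le.2 h1)

lemma IsSurfacePath.exists_face_left_ne (h : P.IsSurfacePath p q γ) {t : ℝ} (ht0 : 0 ≤ t)
    (ht1 : t ≤ 1) (hp : γ t ≠ p) : ∃ (F : P.Face) (r : ℝ), 0 ≤ r ∧ r ≤ t ∧ γ t ∈ F.pts ∧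
      γ r ∈ F.pts ∧ γ r ≠ γ t := by
  obtain ⟨F, r, h1, h2, h3, h4, h5⟩ := h.reverse.exists_face_right_ne (t := 1 - t) (by linarith)
    (by linarith) (by simpa using hp)
  simp only [sub_sub_cancel] at h3 h5
  exact ⟨F, 1 - r, by linarith, by linarith, h3, h4, h5⟩

namespace IsShortestPath

lemma isGeodesicAt (h : P.IsShortestPath p q γ) {s t u : ℝ} (hs : 0 ≤ s) (hst : s ≤ t)
    (htu : t ≤ u) (hu : u ≤ 1) : P.IsGeodesicAt (γ s) (γ t) (γ u) := by
  intro ℓ hℓ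
  have h1 := h.variation_le hs (hst.trans htu) hu hℓ
  rw [← eVariationOn_split hst htu] at h1
  exact (add_le_add (eVariationOn.edist_le γ (left_mem_Icc.2 hst) (right_mem_Icc.2 hst))
    (eVariationOn.edist_le γ (left_mem_Icc.2 htu) (right_mem_Icc.2 htu))).trans h1

/-- A shortest path does not pass through vertices. -/
lemma notMem_exposedPoints (h : P.IsShortestPath p q γ) {t : ℝ} (ht : t ∈ Icc (0 : ℝ) 1)
    (hp : γ t ≠ p) (hq : γ t ≠ q) : γ t ∉ P.carrier.exposedPoints ℝ := by
  obtain ⟨A, s, hs0, hst, hA, hA', hne⟩ := h.1.exists_face_left_ne ht.1 ht.2 hp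
  obtain ⟨B, u, htu, hu, hB, hB', hne'⟩ := h.1.exists_face_right_ne ht.1 ht.2 hq
  exact (h.isGeodesicAt hs0 hst htu hu).notMem_exposedPoints hA' hA hB hB' hne hne'

end IsShortestPath

end Germs

end ConvexUnitPolyhedron

/-! ### Sequences of faces along a shortest path. -/

namespace ConvexUnitPolyhedron

variable {P : ConvexUnitPolyhedron}

lemma notMem_exposedPoints_of_mem_face {F : P.Face} {v a : E3} (ha : a ∈ F.pts) (hv : v ∈ F.pts)
    (h : a ≠ v) {r : ℝ} (hr0 : 0 < r) (hr : r < dist a v) :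
    v + r • dir v a ∉ P.carrier.exposedPoints ℝ := by
  intro hx
  have hd := dist_pos.2 h
  have h1 := (mem_extremePoints.1 (exposedPoints_subset_extremePoints hx)).2 v
    (F.subset_carrier hv) a (F.subset_carrier ha) ?_
  · have h2 := dist_add_smul_dir h hr0.le
    rw [← h1.1, dist_self] at h2
    exact hr0.ne h2
  · rw [openSegment_eq_image']
    refine ⟨r / dist a v, ⟨by positivity, (div_lt_one hd).2 hr⟩, ?_⟩
    rw [dir, smul_smul, div_eq_mul_inv]

lemma Face.exists_ne (F : P.Face) (v : E3) : ∃ a ∈ F.pts, a ≠ v := by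
  by_contra! h
  have h1 : F.pts.Subsingleton := fun x hx y hy => (h x hx).trans (h y hy).symm
  have h2 := F.finrank_eq
  rw [(vectorSpan_eq_bot_iff_subsingleton ℝ).2 h1] at h2
  simp at h2

/-- The faces at a point of the surface are connected with each other through adjacent faces at
this point. -/
theorem reflTransGen_of_mem {v : E3} {F G : P.Face} (hF : v ∈ F.pts) (hG : v ∈ G.pts) :
    Relation.ReflTransGen (fun H H' : P.Face => P.faceGraph.Adj H H' ∧ v ∈ H'.pts) F G := by
  by_cases hv : v ∈ P.carrier.exposedPoints ℝ
  swap
  · by_cases hFG : F = G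
    · rw [hFG]
    · exact .single ⟨adj_of_mem hFG ⟨hF, hG⟩ hv, hG⟩
  obtain ⟨a, haF, hav⟩ := F.exists_ne v
  obtain ⟨b, hbG, hbv⟩ := G.exists_ne v
  obtain ⟨ρ, hρ, hball⟩ : ∃ ρ > 0, ∀ H : P.Face, v ∉ H.pts → ∀ z ∈ H.pts, ρ ≤ dist z v := by
    have hcl : IsClosed (⋃ H ∈ {H : P.Face | v ∉ H.pts}, H.pts) :=
      (toFinite _).isClosed_biUnion fun F _ => F.isCompact.isClosed
    have hn : v ∈ (⋃ H ∈ {H : P.Face | v ∉ H.pts}, H.pts)ᶜ := by simp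
    obtain ⟨ρ, hρ, hb⟩ := Metric.isOpen_iff.1 hcl.isOpen_compl v hn
    refine ⟨ρ, hρ, fun H hH z hz => ?_⟩
    by_contra! h
    refine hb (Metric.mem_ball.2 h) ?_
    simp only [mem_iUnion]
    exact ⟨H, hH, hz⟩
  have hda := dist_pos.2 hav
  have hdb := dist_pos.2 hbv
  -- The path `σ` below starts at distance `r` from `v` and has length at most `2 * r`. With `3 * r
  -- < ρ` it meets only faces through `v`.
  obtain ⟨r, hr0, hra, hrb, hrρ⟩ : ∃ r : ℝ, 0 < r ∧ r < dist a v ∧ r < dist b v ∧ 3 * r < ρ := by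
    refine ⟨min (min (dist a v / 2) (dist b v / 2)) (ρ / 4), by positivity, ?_, ?_, ?_⟩
    · linarith [min_le_left (min (dist a v / 2) (dist b v / 2)) (ρ / 4),
        min_le_left (dist a v / 2) (dist b v / 2)]
    · linarith [min_le_left (min (dist a v / 2) (dist b v / 2)) (ρ / 4),
        min_le_right (dist a v / 2) (dist b v / 2)]
    · linarith [min_le_right (min (dist a v / 2) (dist b v / 2)) (ρ / 4)]
  set x := v + r • dir v a with hx
  set y := v + r • dir v b with hy
  have hxF : x ∈ F.pts := add_smul_dir_mem haF hF hav hr0.le hra.le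
  have hyG : y ∈ G.pts := add_smul_dir_mem hbG hG hbv hr0.le hrb.le
  have hxv : dist x v = r := dist_add_smul_dir hav hr0.le
  have hyv : dist y v = r := dist_add_smul_dir hbv hr0.le
  obtain ⟨σ, hσ⟩ := exists_isShortestPath (F.subset_surface hxF) (G.subset_surface hyG)
  have hlen : eVariationOn σ (Icc 0 1) ≤ ENNReal.ofReal (2 * r) := by
    obtain ⟨η, hη, hle⟩ := (PathLE.of_mem_face hxF hF).trans (PathLE.of_mem_face hG hyG)
    refine (hσ.2 η hη).trans (hle.trans ?_)
    rw [edist_dist, edist_dist, dist_comm v y, hxv, hyv, ← ENNReal.ofReal_add hr0.le hr0.le,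
      two_mul]
  have hnear : ∀ t ∈ Icc (0 : ℝ) 1, ∀ H : P.Face, σ t ∈ H.pts → v ∈ H.pts := by
    intro t ht H hH
    by_contra hvH
    have h1 := hball H hvH _ hH
    have h2 := (eVariationOn.edist_le σ ht (left_mem_Icc.2 zero_le_one)).trans hlen
    rw [hσ.1.source, edist_dist, ENNReal.ofReal_le_ofReal_iff (by positivity)] at h2
    linarith [dist_triangle (σ t) x v]
  -- The endpoints of `σ` are interior to segments in faces, hence not vertices either. So distinct
  -- faces meeting at a point of `σ` are adjacent.
  have hvert : ∀ t ∈ Icc (0 : ℝ) 1, σ t ∉ P.carrier.exposedPoints ℝ := by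
    intro t ht
    by_cases h1 : σ t = x
    · rw [h1]; exact notMem_exposedPoints_of_mem_face haF hF hav hr0 hra
    by_cases h2 : σ t = y
    · rw [h2]; exact notMem_exposedPoints_of_mem_face hbG hG hbv hr0 hrb
    exact hσ.notMem_exposedPoints ht h1 h2
  set R := fun H H' : P.Face => P.faceGraph.Adj H H' ∧ v ∈ H'.pts with hR
  by_contra hno
  have hclosed : ∀ s : Set P.Face, IsClosed (Icc (0 : ℝ) 1 ∩ σ ⁻¹' ⋃ H ∈ s, H.pts) := fun s =>
    hσ.1.continuousOn.preimage_isClosed_of_isClosed isClosed_Icc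
      ((toFinite _).isClosed_biUnion fun F _ => F.isCompact.isClosed)
  -- The times spent in faces linked to `F` and in faces not linked to `F` form two closed sets
  -- covering `[0, 1]`. By connectedness they share a time, at which an unlinked face is adjacent to
  -- a linked one.
  have hconn := isPreconnected_closed_iff.1 (isPreconnected_Icc (a := (0 : ℝ)) (b := 1)) _ _
    (hclosed {H | Relation.ReflTransGen R F H}) (hclosed {H | ¬ Relation.ReflTransGen R F H}) ?_ ?_ ?_
  · obtain ⟨t, ht, ⟨-, h1⟩, ⟨-, h2⟩⟩ := hconn
    simp only [mem_preimage, mem_iUnion] at h1 h2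
    obtain ⟨H, hH, hHt⟩ := h1
    obtain ⟨H', hH', hHt'⟩ := h2
    have hne : H ≠ H' := fun h => hH' (h ▸ hH)
    exact hH' (Relation.ReflTransGen.tail hH
      ⟨adj_of_mem hne ⟨hHt, hHt'⟩ (hvert t ht), hnear t ht _ hHt'⟩)
  · intro t ht
    obtain ⟨H, hH⟩ := exists_face_of_mem_surface (hσ.1.mem_surface t ht)
    by_cases h : Relation.ReflTransGen R F H
    · left
      refine ⟨ht, ?_⟩
      simp only [mem_preimage, mem_iUnion]
      exact ⟨H, h, hH⟩
    · right
      refine ⟨ht, ?_⟩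
      simp only [mem_preimage, mem_iUnion]
      exact ⟨H, h, hH⟩
  · refine ⟨0, left_mem_Icc.2 zero_le_one, left_mem_Icc.2 zero_le_one, ?_⟩
    simp only [mem_preimage, mem_iUnion]
    exact ⟨F, Relation.ReflTransGen.refl, by rwa [hσ.1.source]⟩
  · refine ⟨1, right_mem_Icc.2 zero_le_one, right_mem_Icc.2 zero_le_one, ?_⟩
    simp only [mem_preimage, mem_iUnion]
    exact ⟨G, hno, by rwa [hσ.1.target]⟩

/-- The curve `γ` runs, up to the time `t`, successively through the faces `f 0, …, f k`, which are
consecutively adjacent; it is in `f i` between the times `s i` and `s (i + 1)`. -/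
structure IsFaceSeq (γ : ℝ → E3) (f : ℕ → P.Face) (s : ℕ → ℝ) (k : ℕ) (t : ℝ) : Prop where
  zero : s 0 = 0
  mono : Monotone s
  last : ∀ i > k, s i = t
  adj : ∀ i < k, P.faceGraph.Adj (f i) (f (i + 1))
  mem : ∀ i ≤ k, ∀ r ∈ Icc (s i) (s (i + 1)), γ r ∈ (f i).pts

namespace IsFaceSeq

variable {γ : ℝ → E3} {f : ℕ → P.Face} {s : ℕ → ℝ} {k : ℕ} {t : ℝ}

lemma le_last (h : IsFaceSeq γ f s k t) (i : ℕ) : s i ≤ t := by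
  rw [← h.last (max i (k + 1)) (by omega)]
  exact h.mono (le_max_left _ _)

lemma nonneg (h : IsFaceSeq γ f s k t) (i : ℕ) : 0 ≤ s i := h.zero ▸ h.mono (Nat.zero_le i)

lemma mem_left (h : IsFaceSeq γ f s k t) {i : ℕ} (hi : i ≤ k) : γ (s i) ∈ (f i).pts :=
  h.mem i hi _ (left_mem_Icc.2 (h.mono (Nat.le_succ i)))

lemma mem_right (h : IsFaceSeq γ f s k t) {i : ℕ} (hi : i ≤ k) : γ (s (i + 1)) ∈ (f i).pts :=
  h.mem i hi _ (right_mem_Icc.2 (h.mono (Nat.le_succ i)))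

/-- A sequence of faces is prolonged by staying longer in the last face. -/
lemma extend_time (h : IsFaceSeq γ f s k t) {t' : ℝ} (ht : t ≤ t')
    (hm : ∀ r ∈ Icc (s k) t', γ r ∈ (f k).pts) :
    IsFaceSeq γ f (fun i => if i ≤ k then s i else t') k t' := by
  refine ⟨by simpa using h.zero, ?_, fun i hi => if_neg (by omega), h.adj, ?_⟩
  · refine monotone_nat_of_le_succ fun i => ?_
    split_ifs with h1 h2
    · exact h.mono (Nat.le_succ i)
    · exact (h.le_last i).trans ht
    · omega
    · exact le_rfl
  · intro i hi r hr
    rcases hi.eq_or_lt with h1 | h1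
    · subst h1
      simp only [le_refl, if_true, Nat.not_succ_le_self, if_false] at hr
      exact hm r hr
    · rw [if_pos hi, if_pos (by omega)] at hr
      exact h.mem i hi r hr

/-- A sequence of faces is prolonged by passing to an adjacent face. -/
lemma extend_face (h : IsFaceSeq γ f s k t) {H : P.Face} (hadj : P.faceGraph.Adj (f k) H)
    (hm : γ t ∈ H.pts) : IsFaceSeq γ (fun i => if i ≤ k then f i else H) s (k + 1) t := by
  refine ⟨h.zero, h.mono, fun i hi => h.last i (by omega), ?_, ?_⟩
  · intro i hi
    rw [if_pos (by omega)]
    split_ifs with h1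
    · exact h.adj i (by omega)
    · have : i = k := by omega
      rwa [this]
  · intro i hi r hr
    split_ifs with h1
    · exact h.mem i h1 r hr
    · rw [h.last i (by omega), h.last (i + 1) (by omega), Icc_self, mem_singleton_iff] at hr
      rwa [hr]

/-- A sequence of faces is shortened by omitting the `c` faces after the `i`-th. -/
lemma shortcut (h : IsFaceSeq γ f s k t) {i c : ℕ} (hic : i + c ≤ k)
    (hm : ∀ r ∈ Icc (s i) (s (i + c + 1)), γ r ∈ (f i).pts)
    (hadj : i + c < k → P.faceGraph.Adj (f i) (f (i + c + 1))) :
    IsFaceSeq γ (fun n => if n ≤ i then f n else f (n + c))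
      (fun n => if n ≤ i then s n else s (n + c)) (k - c) t := by
  refine ⟨by simpa using h.zero, ?_, ?_, ?_, ?_⟩
  · refine monotone_nat_of_le_succ fun n => ?_
    split_ifs <;> first | omega | exact h.mono (by omega)
  · intro n hn
    rw [if_neg (by omega)]
    exact h.last _ (by omega)
  · intro n hn
    rcases lt_trichotomy n i with h1 | h1 | h1
    · rw [if_pos h1.le, if_pos (by omega)]
      exact h.adj n (by omega)
    · subst h1
      rw [if_pos le_rfl, if_neg (by omega), Nat.add_right_comm]
      exact hadj (by omega)
    · rw [if_neg (by omega), if_neg (by omega), Nat.add_right_comm]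
      exact h.adj _ (by omega)
  · intro n hn r hr
    rcases lt_trichotomy n i with h1 | h1 | h1
    · rw [if_pos h1.le, if_pos (by omega)] at hr
      rw [if_pos h1.le]
      exact h.mem n (by omega) r hr
    · subst h1
      rw [if_pos le_rfl, if_neg (by omega), Nat.add_right_comm] at hr
      rw [if_pos le_rfl]
      exact hm r hr
    · rw [if_neg (by omega), if_neg (by omega), Nat.add_right_comm] at hr
      rw [if_neg (by omega)]
      exact h.mem _ (by omega) r hr

end IsFaceSeq

variable {p q : E3} {γ : ℝ → E3}

/-- A shortest path runs through a sequence of consecutively adjacent faces, whose first and last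
terms are any given faces at the endpoints. -/
theorem IsShortestPath.exists_isFaceSeq (h : P.IsShortestPath p q γ) {A B : P.Face}
    (hp : p ∈ A.pts) (hq : q ∈ B.pts) :
    ∃ (k : ℕ) (f : ℕ → P.Face) (s : ℕ → ℝ), f 0 = A ∧ f k = B ∧ IsFaceSeq γ f s k 1 := by
  set Reach : P.Face → ℝ → Prop := fun G t => ∃ (k : ℕ) (f : ℕ → P.Face) (s : ℕ → ℝ),
    f 0 = A ∧ f k = G ∧ IsFaceSeq γ f s k t with hReach
  -- The sequence turns about the point `γ t`; the added faces occupy the single time `t`.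
  have hturn : ∀ {G H : P.Face} {t : ℝ}, Reach G t → γ t ∈ G.pts → γ t ∈ H.pts → Reach H t := by
    intro G H t hG hGt hHt
    have hGH := reflTransGen_of_mem hGt hHt
    clear hHt
    induction hGH with
    | refl => exact hG
    | tail _ hadj ih =>
      obtain ⟨k, f, s, h1, h2, h3⟩ := ih
      refine ⟨k + 1, _, s, ?_, ?_, h3.extend_face (h2 ▸ hadj.1) hadj.2⟩
      · simpa using h1
      · simp
  have hcont : ∀ {G : P.Face} {t t' : ℝ}, 0 ≤ t → t ≤ t' → t' ≤ 1 → γ t ∈ G.pts → γ t' ∈ G.pts →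
      Reach G t → Reach G t' := by
    rintro G t t' ht0 htt' ht'1 hGt hGt' ⟨k, f, s, h1, h2, h3⟩
    refine ⟨k, f, _, h1, h2, h3.extend_time htt' fun r hr => ?_⟩
    exact h.mem_of_mem_of_mem (h3.nonneg k) hr.1 hr.2 ht'1 (h3.mem_left le_rfl) (h2 ▸ hGt')
  have hmax : ∀ (G : P.Face) (t : ℝ), t ∈ Icc (0 : ℝ) 1 → γ t ∈ G.pts → Reach G t →
      t ≤ sSup (Icc 0 1 ∩ γ ⁻¹' G.pts) ∧ (sSup (Icc 0 1 ∩ γ ⁻¹' G.pts) ∈ Icc (0 : ℝ) 1 ∧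
      γ (sSup (Icc 0 1 ∩ γ ⁻¹' G.pts)) ∈ G.pts ∧ Reach G (sSup (Icc 0 1 ∩ γ ⁻¹' G.pts))) := by
    intro G t ht hGt hR
    have hc : IsCompact (Icc 0 1 ∩ γ ⁻¹' G.pts) := isCompact_Icc.of_isClosed_subset
      (h.1.continuousOn.preimage_isClosed_of_isClosed isClosed_Icc G.isCompact.isClosed)
      inter_subset_left
    have h1 := hc.sSup_mem ⟨t, ht, hGt⟩
    have h2 := le_csSup hc.bddAbove (show t ∈ Icc 0 1 ∩ γ ⁻¹' G.pts from ⟨ht, hGt⟩)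
    exact ⟨h2, h1.1, h1.2, hcont ht.1 h2 h1.1.2 hGt h1.2 hR⟩
  have h0 : Reach A 0 := by
    refine ⟨0, fun _ => A, fun _ => 0, rfl, rfl, rfl, monotone_const, fun _ _ => rfl, ?_, ?_⟩
    · intro i hi; omega
    · intro i _ r hr
      rw [Icc_self, mem_singleton_iff] at hr
      rwa [hr, h.1.source]
  have h01 := hmax A 0 (left_mem_Icc.2 zero_le_one) (by rwa [h.1.source]) h0
  -- Among the faces reached up to their last visit, take one whose last visit is latest. Before
  -- time `1`, `exists_face_right` would lead on to a later one.
  obtain ⟨G, ⟨hG1, hG2, hG3⟩, hGmax⟩ := (toFinite {G : P.Face |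
    sSup (Icc 0 1 ∩ γ ⁻¹' G.pts) ∈ Icc (0 : ℝ) 1 ∧ γ (sSup (Icc 0 1 ∩ γ ⁻¹' G.pts)) ∈ G.pts ∧
    Reach G (sSup (Icc 0 1 ∩ γ ⁻¹' G.pts))}).exists_maximalFor
      (fun G => sSup (Icc 0 1 ∩ γ ⁻¹' G.pts)) _ ⟨A, h01.2⟩
  set T := sSup (Icc 0 1 ∩ γ ⁻¹' G.pts)
  have hT : T = 1 := by
    by_contra hT
    obtain ⟨H, r, hr, hr1, hH1, hH2⟩ := h.1.exists_face_right hG1.1 (hG1.2.lt_of_ne hT)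
    have hRr := hcont hG1.1 hr.le hr1 hH1 hH2 (hturn hG3 hG2 hH1)
    have h2 := hmax H r ⟨hG1.1.trans hr.le, hr1⟩ hH2 hRr
    have h3 := hGmax h2.2 (hr.le.trans h2.1)
    exact absurd (hr.trans_le (h2.1.trans h3)) (lt_irrefl _)
  rw [hT] at hG2 hG3
  exact hturn hG3 hG2 (by rwa [h.1.target])

/-- The sequence of faces of a shortest path can be chosen without repetitions, and without
detours about points which are not vertices. -/
theorem IsShortestPath.exists_isFaceSeq_injOn (h : P.IsShortestPath p q γ) {A B : P.Face}
    (hp : p ∈ A.pts) (hq : q ∈ B.pts) :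
    ∃ (k : ℕ) (f : ℕ → P.Face) (s : ℕ → ℝ), f 0 = A ∧ f k = B ∧ IsFaceSeq γ f s k 1 ∧
      (∀ i j, i < j → j ≤ k → f i ≠ f j) ∧
      ∀ i j, i < j → j ≤ k → γ (s j) ∈ (f i).pts → γ (s j) ∉ P.carrier.exposedPoints ℝ →
        j = i + 1 := by
  classical
  have hex := h.exists_isFaceSeq hp hq
  obtain ⟨f, s, h1, h2, h3⟩ := Nat.find_spec hex
  set k := Nat.find hex with hk
  -- Minimality of `k` forbids omitting `c > 0` faces. If the omission runs to the end, `f i`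
  -- becomes the last face and must equal `f k`.
  have hmin : ∀ c i, 0 < c → i + c ≤ k → (∀ r ∈ Icc (s i) (s (i + c + 1)), γ r ∈ (f i).pts) →
      (i + c < k → P.faceGraph.Adj (f i) (f (i + c + 1))) → (i + c = k → f i = f k) → False := by
    intro c i hc hic hm hadj hlast
    refine Nat.find_min hex (m := k - c) (by omega) ⟨_, _, ?_, ?_, h3.shortcut hic hm hadj⟩
    · simpa using h1
    · by_cases hik : i + c = k
      · rw [if_pos (by omega), show k - c = i by omega, hlast hik, h2]
      · rw [if_neg (by omega), show k - c + c = k by omega, h2]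
  have hne : ∀ i j, i < j → j ≤ k → f i ≠ f j := by
    intro i j hij hjk hf
    have e : i + (j - i) = j := by omega
    refine hmin (j - i) i (by omega) (by omega) ?_ ?_ ?_
    · intro r hr
      rw [e] at hr
      exact h.mem_of_mem_of_mem (h3.nonneg i) hr.1 hr.2 (h3.le_last _) (h3.mem_left (by omega))
        (hf ▸ h3.mem_right hjk)
    · intro hlt
      rw [e] at hlt ⊢
      rw [hf]
      exact h3.adj j hlt
    · intro hjk'
      rw [hf, ← e, hjk']
  refine ⟨k, f, s, h1, h2, h3, hne, ?_⟩
  intro i j hij hjk hm hv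
  by_contra hj
  -- Only the faces strictly between `i` and `j` are omitted, since `f i` and `f j` are adjacent.
  -- For a repetition, above, `f j` is omitted as well.
  have e : i + (j - i - 1) + 1 = j := by omega
  refine hmin (j - i - 1) i (by omega) (by omega) ?_ ?_ (by omega)
  · intro r hr
    rw [e] at hr
    exact h.mem_of_mem_of_mem (h3.nonneg i) hr.1 hr.2 (h3.le_last _) (h3.mem_left (by omega)) hm
  · intro _
    rw [e]
    exact adj_of_mem (hne i j hij hjk) ⟨hm, h3.mem_left hjk⟩ hv

end ConvexUnitPolyhedron

/-! ### Unfolding faces into the plane. -/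

namespace ConvexUnitPolyhedron

variable {P : ConvexUnitPolyhedron}

/-- In the plane of a face `F`, an edge `uv` shared with another face is completed to an
orthonormal frame by a unit vector pointing to the side of `F`. -/
lemma exists_frame {F G : P.Face} (hFG : F ≠ G) {u v : E3} (huv : F.pts ∩ G.pts = segment ℝ u v)
    (hd : dist u v = 1) : ∃ m : E3, ‖m‖ = 1 ∧ inner ℝ (v - u) m = 0 ∧
      m ∈ vectorSpan ℝ F.pts ∧ (∀ x ∈ F.pts, 0 ≤ inner ℝ m (x - u)) ∧
      ∀ X ∈ vectorSpan ℝ F.pts, X = inner ℝ (v - u) X • (v - u) + inner ℝ m X • m := by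
  have hu : u ∈ F.pts ∩ G.pts := huv ▸ left_mem_segment ℝ u v
  have hv : v ∈ F.pts ∩ G.pts := huv ▸ right_mem_segment ℝ u v
  set w := v - u with hw
  have hw1 : ‖w‖ = 1 := by rw [hw, ← dist_eq_norm, dist_comm, hd]
  have hww : inner ℝ w w = 1 := by rw [real_inner_self_eq_norm_sq, hw1, one_pow]
  have hwV : w ∈ vectorSpan ℝ F.pts := vsub_mem_vectorSpan ℝ hv.1 hu.1
  obtain ⟨e, heV, hew⟩ : ∃ e ∈ vectorSpan ℝ F.pts, e ∉ Submodule.span ℝ {w} := by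
    by_contra! h
    have h1 := Submodule.finrank_mono (R := ℝ) (s := vectorSpan ℝ F.pts)
      (t := Submodule.span ℝ {w}) h
    have h2 := finrank_span_singleton (K := ℝ) (v := w) (fun h => by simp [h] at hw1)
    rw [F.finrank_eq] at h1
    omega
  obtain ⟨m, hm1, hwm, hmV⟩ : ∃ m : E3, ‖m‖ = 1 ∧ inner ℝ w m = 0 ∧ m ∈ vectorSpan ℝ F.pts := by
    have h0 : e - inner ℝ w e • w ≠ 0 := fun h => hew (by
      rw [sub_eq_zero.1 h]
      exact Submodule.smul_mem _ _ (Submodule.mem_span_singleton_self w))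
    refine ⟨(‖e - inner ℝ w e • w‖)⁻¹ • (e - inner ℝ w e • w), ?_, ?_, ?_⟩
    · rw [norm_smul, norm_inv, norm_norm, inv_mul_cancel₀ (norm_ne_zero_iff.2 h0)]
    · rw [inner_smul_right, inner_sub_right, inner_smul_right, hww]
      simp
    · exact Submodule.smul_mem _ _ (Submodule.sub_mem _ heV (Submodule.smul_mem _ _ hwV))
  have hdec : ∀ m : E3, ‖m‖ = 1 → inner ℝ w m = 0 → m ∈ vectorSpan ℝ F.pts →
      ∀ X ∈ vectorSpan ℝ F.pts, X = inner ℝ w X • w + inner ℝ m X • m := by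
    intro m hm1 hwm hmV X hX
    have hmm : inner ℝ m m = 1 := by rw [real_inner_self_eq_norm_sq, hm1, one_pow]
    have hmw : inner ℝ m w = 0 := by rw [real_inner_comm, hwm]
    have hli : LinearIndependent ℝ ![w, m] := by
      rw [LinearIndependent.pair_iff]
      intro a b hab
      have h1 := congrArg (inner ℝ w) hab
      have h2 := congrArg (inner ℝ m) hab
      simp only [inner_add_right, inner_smul_right, hww, hwm, hmm, hmw, inner_zero_right] at h1 h2
      exact ⟨by linarith, by linarith⟩
    have hspan : Submodule.span ℝ (range ![w, m]) = vectorSpan ℝ F.pts := by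
      refine Submodule.eq_of_le_of_finrank_eq ?_ ?_
      · rw [Submodule.span_le]
        rintro _ ⟨i, rfl⟩
        fin_cases i
        · exact hwV
        · exact hmV
      · rw [finrank_span_eq_card hli, F.finrank_eq, Fintype.card_fin]
    rw [← hspan, Matrix.range_cons, Matrix.range_cons, Matrix.range_empty, union_empty,
      singleton_union, Submodule.mem_span_pair] at hX
    obtain ⟨a, b, rfl⟩ := hX
    simp [inner_add_right, inner_smul_right, hwm, hmw, hw1, hm1]
  have hGw : G.normal w = 0 := by
    rw [hw, map_sub, Face.normal_eq hu.2, Face.normal_eq hv.2, sub_self]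
  -- If `m` were parallel to `G` too, the planes and hence the faces would coincide. The sign making
  -- `G.normal m` negative is the right one, because `F` lies behind the plane of `G`.
  have hGm : G.normal m ≠ 0 := by
    intro h
    refine hFG (Face.eq_of_vectorSpan_eq hu ?_)
    refine Submodule.eq_of_le_of_finrank_eq (fun X hX => ?_) (by rw [F.finrank_eq, G.finrank_eq])
    rw [G.vectorSpan_eq, hdec m hm1 hwm hmV X hX]
    change G.normal _ = 0
    simp [h, hGw]
  have hside : ∀ m : E3, ‖m‖ = 1 → inner ℝ w m = 0 → m ∈ vectorSpan ℝ F.pts → G.normal m < 0 →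
      ∀ x ∈ F.pts, 0 ≤ inner ℝ m (x - u) := by
    intro m hm1 hwm hmV hlt x hx
    have h1 : G.normal (x - u) ≤ 0 := by
      rw [map_sub, Face.normal_eq hu.2]
      linarith [Face.normal_le (F := G) (F.subset_carrier hx)]
    rw [hdec m hm1 hwm hmV (x - u) (vsub_mem_vectorSpan ℝ hx hu.1)] at h1
    simp only [map_add, map_smul, hGw, smul_eq_mul, mul_zero, zero_add] at h1
    by_contra! h2
    nlinarith
  rcases hGm.lt_or_gt with h | h
  · exact ⟨m, hm1, hwm, hmV, hside m hm1 hwm hmV h, hdec m hm1 hwm hmV⟩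
  · have h1 : ‖-m‖ = 1 := by rw [norm_neg, hm1]
    have h2 : inner ℝ w (-m) = 0 := by rw [inner_neg_right, hwm, neg_zero]
    have h3 := Submodule.neg_mem _ hmV
    exact ⟨-m, h1, h2, h3, hside _ h1 h2 h3 (by simpa using h), hdec _ h1 h2 h3⟩

/-- The affine map with value `o` at `u` whose linear part has the coordinates `⟪w, ·⟫`, `⟪m, ·⟫` in
the frame `e₁`, `e₂`. -/
noncomputable def frameMap (u w m : E3) (o e₁ e₂ : E2) : E3 →ᵃ[ℝ] E2 where
  toFun x := o + (inner ℝ w (x - u) • e₁ + inner ℝ m (x - u) • e₂)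
  linear := (innerₛₗ ℝ w).smulRight e₁ + (innerₛₗ ℝ m).smulRight e₂
  map_vadd' p v := by
    simp only [vadd_eq_add, LinearMap.add_apply, LinearMap.smulRight_apply, innerₛₗ_apply_apply,
      add_sub_assoc, inner_add_right, add_smul]
    abel

lemma frameMap_apply (u w m : E3) (o e₁ e₂ : E2) (x : E3) : frameMap u w m o e₁ e₂ x =
    o + (inner ℝ w (x - u) • e₁ + inner ℝ m (x - u) • e₂) := rfl

lemma frameMap_linear (u w m : E3) (o e₁ e₂ : E2) (X : E3) : (frameMap u w m o e₁ e₂).linear X =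
    inner ℝ w X • e₁ + inner ℝ m X • e₂ := rfl

/-- The affine map `ψ` is isometric on the plane of the face `F`. -/
def IsPlacement (F : P.Face) (ψ : E3 →ᵃ[ℝ] E2) : Prop :=
  ∀ X ∈ vectorSpan ℝ F.pts, ∀ Y ∈ vectorSpan ℝ F.pts,
    inner ℝ (ψ.linear X) (ψ.linear Y) = inner ℝ X Y

lemma IsPlacement.dist_eq {F : P.Face} {ψ : E3 →ᵃ[ℝ] E2} (h : IsPlacement F ψ) {x y : E3}
    (hx : x ∈ F.pts) (hy : y ∈ F.pts) : dist (ψ x) (ψ y) = dist x y := by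
  have h1 : x - y ∈ vectorSpan ℝ F.pts := vsub_mem_vectorSpan ℝ hx hy
  have h2 : ψ x - ψ y = ψ.linear (x - y) := (ψ.linearMap_vsub x y).symm
  rw [dist_eq_norm, dist_eq_norm, h2, @norm_eq_sqrt_real_inner E2, h _ h1 _ h1,
    ← norm_eq_sqrt_real_inner]

lemma isPlacement_frameMap {F : P.Face} {w m : E3} (u : E3) (o : E2) {e₁ e₂ : E2}
    (hw : ‖w‖ = 1) (hm : ‖m‖ = 1) (hwm : inner ℝ w m = 0)
    (hdec : ∀ X ∈ vectorSpan ℝ F.pts, X = inner ℝ w X • w + inner ℝ m X • m)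
    (he₁ : ‖e₁‖ = 1) (he₂ : ‖e₂‖ = 1) (he : inner ℝ e₁ e₂ = 0) :
    IsPlacement F (frameMap u w m o e₁ e₂) := by
  intro X hX Y hY
  have he' : inner ℝ e₂ e₁ = 0 := by rw [real_inner_comm, he]
  have hmw : inner ℝ m w = 0 := by rw [real_inner_comm, hwm]
  rw [frameMap_linear, frameMap_linear]
  conv_rhs => rw [hdec X hX, hdec Y hY]
  simp only [inner_add_left, inner_add_right, real_inner_smul_left, real_inner_smul_right,
    real_inner_self_eq_norm_sq, he, he', hwm, hmw, hw, hm, he₁, he₂]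

/-- The placement `ψ'` of the face `G` unfolds it, about the edge which it shares with the face `F`,
to the side opposite to the placement `ψ` of `F`. -/
structure Unfolds (F G : P.Face) (ψ ψ' : E3 →ᵃ[ℝ] E2) : Prop where
  isPlacement : IsPlacement G ψ'
  glued : ∀ x ∈ F.pts ∩ G.pts, ψ x = ψ' x
  opposite : ∀ a b : E3, F.pts ∩ G.pts = segment ℝ a b → ∀ x ∈ F.pts, ∀ y ∈ G.pts,
    (affineSpan ℝ {ψ a, ψ b}).WOppSide (ψ x) (ψ' y)
  straight : ∀ z ∈ F.pts ∩ G.pts, ∀ a ∈ F.pts, ∀ b ∈ G.pts, a ≠ z → b ≠ z →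
    (∀ d, F.normal d = 0 → G.normal d = 0 → inner ℝ d (dir z a) + inner ℝ d (dir z b) = 0) →
    (dist a z)⁻¹ • (ψ z - ψ a) = (dist b z)⁻¹ • (ψ' b - ψ' z)

theorem exists_unfolds {F G : P.Face} (hFG : P.faceGraph.Adj F G) {ψ : E3 →ᵃ[ℝ] E2}
    (hψ : IsPlacement F ψ) : ∃ ψ', Unfolds F G ψ ψ' := by
  obtain ⟨u, v, huv, hd⟩ := exists_edge hFG
  obtain ⟨m, hm1, hwm, hmV, hmF, hdecF⟩ := exists_frame hFG.1 huv hd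
  obtain ⟨n, hn1, hwn, hnV, hnG, hdecG⟩ := exists_frame hFG.1.symm
    (by rw [inter_comm, huv]) hd
  have hu : u ∈ F.pts ∩ G.pts := huv ▸ left_mem_segment ℝ u v
  have hv : v ∈ F.pts ∩ G.pts := huv ▸ right_mem_segment ℝ u v
  set w := v - u with hw
  have hw1 : ‖w‖ = 1 := by rw [hw, ← dist_eq_norm, dist_comm, hd]
  have hww : inner ℝ w w = 1 := by rw [real_inner_self_eq_norm_sq, hw1, one_pow]
  have hwV : w ∈ vectorSpan ℝ F.pts := vsub_mem_vectorSpan ℝ hv.1 hu.1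
  have hmw : inner ℝ m w = 0 := by rw [real_inner_comm, hwm]
  have hnw : inner ℝ n w = 0 := by rw [real_inner_comm, hwn]
  have norm_lin : ∀ X ∈ vectorSpan ℝ F.pts, ‖ψ.linear X‖ = ‖X‖ := fun X hX => by
    rw [@norm_eq_sqrt_real_inner E2, hψ X hX X hX, ← norm_eq_sqrt_real_inner]
  have hψF : ∀ x, ψ x = ψ u + ψ.linear (x - u) := fun x => by
    have : ψ.linear (x - u) = ψ x - ψ u := ψ.linearMap_vsub x u
    rw [this]; abel
  have hedge : ∀ x ∈ F.pts ∩ G.pts, ∃ t : ℝ, x - u = t • w := by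
    intro x hx
    rw [huv, segment_eq_image'] at hx
    obtain ⟨t, -, rfl⟩ := hx
    exact ⟨t, by simp [hw]⟩
  have hmz : ∀ x ∈ F.pts ∩ G.pts, inner ℝ m (x - u) = 0 := fun x hx => by
    obtain ⟨t, ht⟩ := hedge x hx
    rw [ht, inner_smul_right, hmw, mul_zero]
  have hnz : ∀ x ∈ F.pts ∩ G.pts, inner ℝ n (x - u) = 0 := fun x hx => by
    obtain ⟨t, ht⟩ := hedge x hx
    rw [ht, inner_smul_right, hnw, mul_zero]
  -- `m` points into `F` and `n` into `G`; sending `n` to `-ψ.linear m` puts `G` on the other side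
  -- of the common edge.
  refine ⟨frameMap u w n (ψ u) (ψ.linear w) (-ψ.linear m), ?_, ?_, ?_, ?_⟩
  · refine isPlacement_frameMap u _ hw1 hn1 hwn hdecG ?_ ?_ ?_
    · rw [norm_lin w hwV, hw1]
    · rw [norm_neg, norm_lin m hmV, hm1]
    · rw [inner_neg_right, hψ w hwV m hmV, hwm, neg_zero]
  · intro x hx
    obtain ⟨t, ht⟩ := hedge x hx
    rw [frameMap_apply, hψF x, hnz x hx, ht, map_smul, inner_smul_right, hww]
    simp
  · intro a b hab x hx y hy
    have hline : ∀ t : ℝ, ψ (u + t • w) ∈ affineSpan ℝ {ψ a, ψ b} := by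
      intro t
      have h1 : u + t • w ∈ affineSpan ℝ {a, b} := by
        have h2 : affineSpan ℝ {a, b} = affineSpan ℝ {u, v} := by
          rw [← affineSpan_convexHull, ← affineSpan_convexHull (s := {u, v}), convexHull_pair,
            convexHull_pair, ← hab, ← huv]
        rw [h2, add_comm]
        exact AffineMap.lineMap_mem_affineSpan_pair t u v
      have h3 := AffineSubspace.mem_map_of_mem ψ h1
      rwa [AffineSubspace.map_span, image_pair] at h3
    -- The witnesses are the feet of the perpendiculars to the edge line; both offsets are
    -- nonnegative multiples of `ψ.linear m`.
    refine ⟨ψ (u + inner ℝ w (x - u) • w), hline _, ψ (u + inner ℝ w (y - u) • w), hline _, ?_⟩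
    have e1 : ψ x -ᵥ ψ (u + inner ℝ w (x - u) • w) = inner ℝ m (x - u) • ψ.linear m := by
      rw [← ψ.linearMap_vsub, ← map_smul]
      congr 1
      rw [vsub_eq_sub, ← sub_sub, sub_eq_iff_eq_add, add_comm]
      exact hdecF _ (vsub_mem_vectorSpan ℝ hx hu.1)
    have e2 : ψ (u + inner ℝ w (y - u) • w) -ᵥ frameMap u w n (ψ u) (ψ.linear w) (-ψ.linear m) y =
        inner ℝ n (y - u) • ψ.linear m := by
      rw [frameMap_apply, hψF (u + _), add_sub_cancel_left, map_smul, vsub_eq_sub, smul_neg]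
      abel
    rw [e1, e2]
    exact (SameRay.rfl.nonneg_smul_left (hmF x hx)).nonneg_smul_right (hnG y hy)
  · intro z hz a ha b hb haz hbz hstr
    have hsub : ∀ (φ : E3 →ᵃ[ℝ] E2) (x y : E3), φ x - φ y = φ.linear (x - y) := fun φ x y =>
      (φ.linearMap_vsub x y).symm
    have hdF : F.normal w = 0 := by
      rw [hw, map_sub, Face.normal_eq hu.1, Face.normal_eq hv.1, sub_self]
    have hdG : G.normal w = 0 := by
      rw [hw, map_sub, Face.normal_eq hu.2, Face.normal_eq hv.2, sub_self]
    have h1 := hstr w hdF hdG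
    have hα : dir z a ∈ vectorSpan ℝ F.pts :=
      Submodule.smul_mem _ _ (vsub_mem_vectorSpan ℝ ha hz.1)
    have hβ : dir z b ∈ vectorSpan ℝ G.pts :=
      Submodule.smul_mem _ _ (vsub_mem_vectorSpan ℝ hb hz.2)
    have hα2 : 0 ≤ inner ℝ m (dir z a) := by
      rw [dir, inner_smul_right, ← sub_sub_sub_cancel_right a z u, inner_sub_right, hmz z hz,
        sub_zero]
      exact mul_nonneg (by positivity) (hmF a ha)
    have hβ2 : 0 ≤ inner ℝ n (dir z b) := by
      rw [dir, inner_smul_right, ← sub_sub_sub_cancel_right b z u, inner_sub_right, hnz z hz,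
        sub_zero]
      exact mul_nonneg (by positivity) (hnG b hb)
    -- Equal angles make the coordinates along `w` opposite. The directions are unit vectors with
    -- nonnegative coordinates along `m` and `n`, so these coordinates agree.
    have hsq : ∀ (k X : E3), ‖k‖ = 1 → inner ℝ w k = 0 →
        X = inner ℝ w X • w + inner ℝ k X • k → ‖X‖ = 1 →
        inner ℝ w X ^ 2 + inner ℝ k X ^ 2 = 1 := by
      intro k X hk hwk hX hX1
      have h2 : ‖X‖ ^ 2 = 1 := by rw [hX1, one_pow]
      rw [← real_inner_self_eq_norm_sq] at h2
      nth_rewrite 1 [hX] at h2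
      rw [inner_add_left, real_inner_smul_left, real_inner_smul_left] at h2
      linarith
    have h2 := hsq m _ hm1 hwm (hdecF _ hα) (norm_dir haz)
    have h3 := hsq n _ hn1 hwn (hdecG _ hβ) (norm_dir hbz)
    have h4 : inner ℝ w (dir z b) = - inner ℝ w (dir z a) := by linarith
    have h5 : inner ℝ n (dir z b) = inner ℝ m (dir z a) := by
      rw [h4] at h3
      nlinarith
    have e1 : (dist a z)⁻¹ • (ψ z - ψ a) = -ψ.linear (dir z a) := by
      rw [hsub, ← map_smul, ← map_neg, dir, ← smul_neg, neg_sub]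
    have e2 : (dist b z)⁻¹ • (frameMap u w n (ψ u) (ψ.linear w) (-ψ.linear m) b -
        frameMap u w n (ψ u) (ψ.linear w) (-ψ.linear m) z) =
        (frameMap u w n (ψ u) (ψ.linear w) (-ψ.linear m)).linear (dir z b) := by
      rw [hsub, ← map_smul, dir]
    rw [e1, e2, frameMap_linear, h4, h5]
    conv_lhs => rw [hdecF _ hα]
    simp only [map_add, map_smul, neg_smul, smul_neg]
    abel

lemma det3_eq (a b c : E3) : det3 a b c = a 0 * b 1 * c 2 - a 0 * b 2 * c 1 - a 1 * b 0 * c 2 +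
    a 1 * b 2 * c 0 + a 2 * b 0 * c 1 - a 2 * b 1 * c 0 := by
  simp [det3, Matrix.det_fin_three]

/-- One of the two orders of the endpoints of an edge of a face is counter-clockwise. -/
lemma isCounterclockwise_or {F G : P.Face} (hFG : F ≠ G) {u v : E3}
    (huv : F.pts ∩ G.pts = segment ℝ u v) (hd : dist u v = 1) :
    P.IsCounterclockwise F u v ∨ P.IsCounterclockwise F v u := by
  obtain ⟨m, hm1, hwm, hmV, hmF, hdec⟩ := exists_frame hFG huv hd
  have hu : u ∈ F.pts ∩ G.pts := huv ▸ left_mem_segment ℝ u v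
  set w := v - u with hw
  have hD : ∀ X ∈ vectorSpan ℝ F.pts, det3 w m X = 0 := by
    intro X hX
    rw [hdec X hX, det3_eq]
    simp only [PiLp.add_apply, PiLp.smul_apply, smul_eq_mul]
    ring
  obtain ⟨Y₀, hY₀⟩ : ∃ Y₀, F.normal Y₀ ≠ 0 := by
    by_contra! h
    exact F.normal_ne_zero (ContinuousLinearMap.ext h)
  -- The determinant is a fixed constant times the product of `inner ℝ m (x - u) ≥ 0` and `F.normal
  -- (y - u)`, which is nonpositive on the polyhedron. The sign of the constant decides the order of
  -- the endpoints.
  have hdet : ∀ x ∈ F.pts, ∀ y, det3 w (x - u) (y - u) =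
      det3 w m Y₀ / F.normal Y₀ * (inner ℝ m (x - u) * F.normal (y - u)) := by
    intro x hx y
    set t := F.normal (y - u) / F.normal Y₀ with ht
    have h1 : (y - u) - t • Y₀ ∈ vectorSpan ℝ F.pts := by
      rw [F.vectorSpan_eq]
      change F.normal _ = 0
      rw [map_sub, map_smul, smul_eq_mul, ht, div_mul_cancel₀ _ hY₀, sub_self]
    have h2 := hD _ h1
    have h3 : det3 w (x - u) (y - u) = inner ℝ m (x - u) * det3 w m (y - u) := by
      conv_lhs => rw [hdec (x - u) (vsub_mem_vectorSpan ℝ hx hu.1)]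
      rw [det3_eq, det3_eq]
      simp only [PiLp.add_apply, PiLp.smul_apply, smul_eq_mul]
      ring
    have h4 : det3 w m ((y - u) - t • Y₀) = det3 w m (y - u) - t * det3 w m Y₀ := by
      rw [det3_eq, det3_eq, det3_eq]
      simp only [PiLp.sub_apply, PiLp.smul_apply, smul_eq_mul]
      ring
    rw [h3, sub_eq_zero.1 (h4.symm.trans h2), ht]
    ring
  have hle : ∀ x ∈ F.pts, ∀ y ∈ P.carrier, inner ℝ m (x - u) * F.normal (y - u) ≤ 0 := by
    intro x hx y hy
    refine mul_nonpos_of_nonneg_of_nonpos (hmF x hx) ?_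
    rw [map_sub, Face.normal_eq hu.1]
    linarith [Face.normal_le (F := F) hy]
  rcases le_total 0 (det3 w m Y₀ / F.normal Y₀) with hc | hc
  · left
    intro x hx y hy
    rw [← hw, hdet x hx y]
    exact mul_nonpos_of_nonneg_of_nonpos hc (hle x hx y hy)
  · right
    intro x hx y hy
    have h1 : det3 (u - v) (x - v) (y - v) = -det3 w (x - u) (y - u) := by
      rw [det3_eq, det3_eq, hw]
      simp only [PiLp.sub_apply]
      ring
    rw [h1, hdet x hx y, neg_nonpos]
    exact mul_nonneg_of_nonpos_of_nonpos hc (hle x hx y hy)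

/-- The initial placement of a face in the upper half-plane. -/
theorem exists_base_placement {F G : P.Face} (hFG : P.faceGraph.Adj F G) :
    ∃ ψ : E3 →ᵃ[ℝ] E2, IsPlacement F ψ ∧ (∃ u v : E3, F.pts ∩ G.pts = segment ℝ u v ∧
      P.IsCounterclockwise F u v ∧ ψ u = !₂[0, 0] ∧ ψ v = !₂[1, 0]) ∧ ∀ x ∈ F.pts, 0 ≤ ψ x 1 := by
  obtain ⟨u, v, huv, hd, hccw⟩ : ∃ u v : E3, F.pts ∩ G.pts = segment ℝ u v ∧ dist u v = 1 ∧
      P.IsCounterclockwise F u v := by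
    obtain ⟨u, v, huv, hd⟩ := exists_edge hFG
    rcases isCounterclockwise_or hFG.1 huv hd with h | h
    · exact ⟨u, v, huv, hd, h⟩
    · exact ⟨v, u, by rw [huv, segment_symm], by rw [dist_comm, hd], h⟩
  obtain ⟨m, hm1, hwm, hmV, hmF, hdec⟩ := exists_frame hFG.1 huv hd
  have hw1 : ‖v - u‖ = 1 := by rw [← dist_eq_norm, dist_comm, hd]
  have hww : inner ℝ (v - u) (v - u) = 1 := by rw [real_inner_self_eq_norm_sq, hw1, one_pow]
  have hmw : inner ℝ m (v - u) = 0 := by rw [real_inner_comm, hwm]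
  refine ⟨frameMap u (v - u) m !₂[0, 0] !₂[1, 0] !₂[0, 1], ?_, ⟨u, v, huv, hccw, ?_, ?_⟩, ?_⟩
  · refine isPlacement_frameMap u _ hw1 hm1 hwm hdec ?_ ?_ ?_
    · simp [EuclideanSpace.norm_eq]
    · simp [EuclideanSpace.norm_eq]
    · simp [PiLp.inner_apply]
  · rw [frameMap_apply]
    simp
  · rw [frameMap_apply, hww, hmw]
    ext i
    fin_cases i <;> simp
  · intro x hx
    rw [frameMap_apply]
    simpa using hmF x hx

end ConvexUnitPolyhedron

/-! ### Landscapes from paths in the face graph. -/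

namespace ConvexUnitPolyhedron

section Graph

variable {V : Type*} {G : SimpleGraph V}

lemma exists_isPath_getVert (k : ℕ) : ∀ f : ℕ → V, (∀ i < k, G.Adj (f i) (f (i + 1))) →
    (∀ i j, i < j → j ≤ k → f i ≠ f j) →
    ∃ w : G.Walk (f 0) (f k), w.length = k ∧ (∀ i ≤ k, w.getVert i = f i) ∧ w.IsPath := by
  induction k with
  | zero =>
    intro f _ _
    refine ⟨.nil, rfl, fun i hi => ?_, .nil⟩
    rw [Nat.le_zero.1 hi]
    simp
  | succ k ih =>
    intro f hadj hne
    obtain ⟨w, hw, hv, hp⟩ := ih (fun i => f (i + 1)) (fun i hi => hadj (i + 1) (by omega))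
      fun i j hij hjk => hne (i + 1) (j + 1) (by omega) (by omega)
    refine ⟨.cons (hadj 0 (by omega)) w, by simp [hw], ?_, ?_⟩
    · rintro (_ | i) hi
      · simp
      · simpa using hv i (by omega)
    · rw [SimpleGraph.Walk.cons_isPath_iff]
      refine ⟨hp, fun hmem => ?_⟩
      obtain ⟨n, hn, hnk⟩ := SimpleGraph.Walk.mem_support_iff_exists_getVert.1 hmem
      rw [hv n (by omega)] at hn
      exact hne 0 (n + 1) (by omega) (by omega) hn.symm

/-- The edges of a path form an acyclic graph. -/
lemma exists_isAcyclic_of_path {f : ℕ → V} (k : ℕ) (hadj : ∀ i < k, G.Adj (f i) (f (i + 1)))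
    (hne : ∀ i j, i < j → j ≤ k → f i ≠ f j) :
    ∃ H ≤ G, H.IsAcyclic ∧ (∀ i < k, H.Adj (f i) (f (i + 1))) ∧
      ∀ a b, H.Adj a b → ∃ i ≤ k, a = f i := by
  induction k with
  | zero =>
    exact ⟨⊥, bot_le, SimpleGraph.isAcyclic_bot, fun i hi => by omega, fun a b h => h.elim⟩
  | succ k ih =>
    obtain ⟨H, hHG, hac, hH, hsupp⟩ := ih (fun i hi => hadj i (by omega))
      fun i j hij hjk => hne i j hij (by omega)
    -- Every edge of `H` joins earlier terms of the sequence, so the new vertex is isolated in `H`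
    -- and the added edge closes no cycle.
    have hnr : ¬ H.Reachable (f (k + 1)) (f k) := by
      rintro ⟨w⟩
      generalize hb : f k = b at w
      cases w with
      | nil => exact hne k (k + 1) (by omega) le_rfl hb
      | cons h _ =>
        obtain ⟨i, hi, hfi⟩ := hsupp _ _ h
        exact hne i (k + 1) (by omega) le_rfl hfi.symm
    refine ⟨H ⊔ SimpleGraph.edge (f (k + 1)) (f k), ?_,
      SimpleGraph.IsAcyclic.sup_edge_of_not_reachable hnr hac, ?_, ?_⟩
    · refine sup_le hHG fun a b hab => ?_
      rw [SimpleGraph.edge_adj] at hab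
      rcases hab.1 with ⟨rfl, rfl⟩ | ⟨rfl, rfl⟩
      · exact (hadj k (by omega)).symm
      · exact hadj k (by omega)
    · intro i hi
      rw [SimpleGraph.sup_adj, SimpleGraph.edge_adj]
      rcases (Nat.lt_succ_iff.1 hi).eq_or_lt with h | h
      · subst h
        exact Or.inr ⟨Or.inr ⟨rfl, rfl⟩, hne _ _ (by omega) le_rfl⟩
      · exact Or.inl (hH i h)
    · intro a b hab
      rw [SimpleGraph.sup_adj, SimpleGraph.edge_adj] at hab
      rcases hab with h | ⟨⟨rfl, rfl⟩ | ⟨rfl, rfl⟩, -⟩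
      · obtain ⟨i, hi, h⟩ := hsupp a b h
        exact ⟨i, by omega, h⟩
      · exact ⟨k + 1, le_rfl, rfl⟩
      · exact ⟨k, by omega, rfl⟩

end Graph

variable {P : ConvexUnitPolyhedron}

/-- A shortest path from a point of one face to a point of the other runs through consecutively
adjacent faces. -/
lemma faceGraph_connected (A : P.Face) : P.faceGraph.Connected := by
  have : Nonempty P.Face := ⟨A⟩
  refine ⟨fun F G => ?_⟩
  obtain ⟨p, hp⟩ := F.nonempty
  obtain ⟨q, hq⟩ := G.nonempty
  obtain ⟨γ, hγ⟩ := exists_isShortestPath (F.subset_surface hp) (G.subset_surface hq)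
  obtain ⟨k, f, s, rfl, rfl, h3⟩ := hγ.exists_isFaceSeq hp hq
  have : ∀ j ≤ k, P.faceGraph.Reachable (f 0) (f j) := by
    intro j
    induction j with
    | zero => exact fun _ => .refl _
    | succ j ih => exact fun hj => (ih (by omega)).trans (h3.adj j (by omega)).reachable
  exact this k le_rfl

/-- A path in the face graph is the path of a landscape. -/
lemma exists_landscape {f : ℕ → P.Face} {k : ℕ} (hk : 1 ≤ k)
    (hadj : ∀ i < k, P.faceGraph.Adj (f i) (f (i + 1)))
    (hne : ∀ i j, i < j → j ≤ k → f i ≠ f j) :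
    ∃ L : P.Landscape (f 0) (f k), L.len = k ∧ ∀ i ≤ k, L.face i = f i := by
  obtain ⟨H, hHG, hac, hH, -⟩ := exists_isAcyclic_of_path k hadj hne
  obtain ⟨T, hHT, hTG, hT⟩ :=
    (faceGraph_connected (f 0)).exists_isTree_le_of_le_of_isAcyclic hHG hac
  obtain ⟨w, hw, hv, hp⟩ := exists_isPath_getVert k f (fun i hi => hHT (hH i hi)) hne
  exact ⟨⟨⟨T, hTG, hT⟩, w, hp, hk.trans hw.ge⟩, hw, hv⟩

/-- A sequence of consecutively adjacent faces is unfolded into the plane. -/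
lemma exists_unfolding {f : ℕ → P.Face} {k : ℕ} (hadj : ∀ i < k, P.faceGraph.Adj (f i) (f (i + 1)))
    {ψ₀ : E3 →ᵃ[ℝ] E2} (h₀ : IsPlacement (f 0) ψ₀) :
    ∃ ψ : ℕ → E3 →ᵃ[ℝ] E2, ψ 0 = ψ₀ ∧ (∀ i ≤ k, IsPlacement (f i) (ψ i)) ∧
      ∀ i < k, Unfolds (f i) (f (i + 1)) (ψ i) (ψ (i + 1)) := by
  -- Made total, with default value `ψ`, so that the placements can be defined by recursion.
  have hex : ∀ (F G : P.Face) (ψ : E3 →ᵃ[ℝ] E2), ∃ ψ', P.faceGraph.Adj F G → IsPlacement F ψ →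
      Unfolds F G ψ ψ' := by
    intro F G ψ
    by_cases h : P.faceGraph.Adj F G ∧ IsPlacement F ψ
    · obtain ⟨ψ', h'⟩ := exists_unfolds h.1 h.2
      exact ⟨ψ', fun _ _ => h'⟩
    · exact ⟨ψ, fun h1 h2 => absurd ⟨h1, h2⟩ h⟩
  choose g hg using hex
  set ψ : ℕ → E3 →ᵃ[ℝ] E2 := fun n => Nat.rec ψ₀ (fun i φ => g (f i) (f (i + 1)) φ) n with hψ
  have hp : ∀ i ≤ k, IsPlacement (f i) (ψ i) := by
    intro i
    induction i with
    | zero => exact fun _ => h₀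
    | succ i ih => exact fun hi => (hg _ _ _ (hadj i (by omega)) (ih (by omega))).isPlacement
  exact ⟨ψ, rfl, hp, fun i hi => hg _ _ _ (hadj i hi) (hp i hi.le)⟩

/-! ### Arc length and straightness of the unfolded path. -/

/-- The length of a path up to the time `t`. -/
noncomputable def lengthTo (γ : ℝ → E3) (t : ℝ) : ℝ :=
  (eVariationOn γ (Icc 0 t)).toReal

namespace IsShortestPath

variable {p q : E3} {γ : ℝ → E3}

lemma lengthTo_sub (h : P.IsShortestPath p q γ) {s t : ℝ} (hs : 0 ≤ s) (hst : s ≤ t)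
    (ht : t ≤ 1) : lengthTo γ t - lengthTo γ s = (eVariationOn γ (Icc s t)).toReal := by
  have h1 : eVariationOn γ (Icc 0 t) ≠ ⊤ := ne_top_of_le_ne_top h.variation_ne_top
    (eVariationOn.mono γ (Icc_subset_Icc le_rfl ht))
  rw [← eVariationOn_split hs hst] at h1
  rw [lengthTo, lengthTo, ← eVariationOn_split hs hst,
    ENNReal.toReal_add (ENNReal.add_ne_top.1 h1).1 (ENNReal.add_ne_top.1 h1).2]
  ring

lemma dist_le_lengthTo_sub (h : P.IsShortestPath p q γ) {s t : ℝ} (hs : 0 ≤ s) (hst : s ≤ t)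
    (ht : t ≤ 1) : dist (γ s) (γ t) ≤ lengthTo γ t - lengthTo γ s := by
  rw [h.lengthTo_sub hs hst ht, dist_edist]
  refine ENNReal.toReal_mono (ne_top_of_le_ne_top h.variation_ne_top
    (eVariationOn.mono γ (Icc_subset_Icc hs ht))) ?_
  exact eVariationOn.edist_le γ (left_mem_Icc.2 hst) (right_mem_Icc.2 hst)

lemma lengthTo_sub_eq (h : P.IsShortestPath p q γ) {s t : ℝ} (hs : 0 ≤ s) (hst : s ≤ t)
    (ht : t ≤ 1) {F : P.Face} (hsF : γ s ∈ F.pts) (htF : γ t ∈ F.pts) :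
    lengthTo γ t - lengthTo γ s = dist (γ s) (γ t) := by
  rw [h.lengthTo_sub hs hst ht, h.variation_eq hs hst ht hsF htF, dist_edist]

lemma monotoneOn_lengthTo (h : P.IsShortestPath p q γ) : MonotoneOn (lengthTo γ) (Icc 0 1) := by
  intro s hs t ht hst
  linarith [h.dist_le_lengthTo_sub hs.1 hst ht.2, dist_nonneg (x := γ s) (y := γ t)]

lemma lengthTo_zero : lengthTo γ 0 = 0 := by
  simp [lengthTo, eVariationOn.subsingleton]

lemma continuousOn_lengthTo (h : P.IsShortestPath p q γ) {k : ℕ} {f : ℕ → P.Face} {s : ℕ → ℝ}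
    (hf : IsFaceSeq γ f s k 1) : ContinuousOn (lengthTo γ) (Icc 0 1) := by
  have key : ∀ j ≤ k + 1, ContinuousOn (lengthTo γ) (Icc 0 (s j)) := by
    intro j
    induction j with
    | zero =>
      intro _
      rw [hf.zero, Icc_self]
      exact continuousOn_singleton _ _
    | succ j ih =>
      intro hj
      rw [← Icc_union_Icc_eq_Icc (hf.nonneg j) (hf.mono (Nat.le_succ j))]
      refine (ih (by omega)).union_of_isClosed ?_ isClosed_Icc isClosed_Icc
      have h1 : ContinuousOn (fun t => lengthTo γ (s j) + dist (γ (s j)) (γ t))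
          (Icc (s j) (s (j + 1))) := by
        refine continuousOn_const.add
          ((continuous_const.dist continuous_id).comp_continuousOn ?_)
        exact h.1.continuousOn.mono (Icc_subset_Icc (hf.nonneg j) (hf.le_last _))
      refine h1.congr fun t ht => ?_
      have h2 := h.lengthTo_sub_eq (hf.nonneg j) ht.1 (ht.2.trans (hf.le_last _))
        (hf.mem_left (by omega : j ≤ k)) (hf.mem j (by omega) t ht)
      dsimp only
      linarith
  rw [← hf.last (k + 1) (by omega)]
  exact key (k + 1) le_rfl

/-- A shortest path unfolds to a straight line, run through with unit speed in terms of arc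
length. -/
theorem exists_direction (h : P.IsShortestPath p q γ) {k : ℕ} {f : ℕ → P.Face} {s : ℕ → ℝ}
    (hf : IsFaceSeq γ f s k 1)
    (hdet : ∀ i j, i < j → j ≤ k → γ (s j) ∈ (f i).pts → γ (s j) ∉ P.carrier.exposedPoints ℝ →
        j = i + 1)
    {ψ : ℕ → E3 →ᵃ[ℝ] E2} (hψ : ∀ i < k, Unfolds (f i) (f (i + 1)) (ψ i) (ψ (i + 1))) :
    ∃ U : E2, ∀ i ≤ k, ∀ t ∈ Icc (s i) (s (i + 1)), ψ i (γ t) = ψ 0 p + lengthTo γ t • U := by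
  -- The unit direction of the unfolded `i`-th piece. It is zero when the endpoints of the piece
  -- coincide, so only the other pieces are compared.
  set D : ℕ → E2 := fun i =>
    (dist (γ (s i)) (γ (s (i + 1))))⁻¹ • (ψ i (γ (s (i + 1))) - ψ i (γ (s i))) with hD
  have hstep : ∀ j ≤ k, ∀ i < j, γ (s i) ≠ γ (s (i + 1)) → γ (s j) ≠ γ (s (j + 1)) →
      D i = D j := by
    intro j
    induction j using Nat.strong_induction_on with
    | _ j ih =>
      intro hjk i hij hi hj
      -- `l` is the last nondegenerate piece before `j`. The path arrives at `γ (s j)` and leaves it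
      -- along nondegenerate pieces, so this point is not a vertex, and `hdet` makes the two pieces
      -- consecutive.
      obtain ⟨l, ⟨hlj, hl⟩, hmax⟩ := (show {n | n < j ∧ γ (s n) ≠ γ (s (n + 1))}.Finite from
        (finite_lt_nat j).subset fun n hn => hn.1).exists_maximal ⟨i, hij, hi⟩
      have hconst : ∀ n, l + 1 ≤ n → n ≤ j → γ (s (l + 1)) = γ (s n) := by
        intro n hn
        induction n, hn using Nat.le_induction with
        | base => exact fun _ => rfl
        | succ n hn ihn =>
          intro hnj
          rw [ihn (by omega)]
          by_contra hne
          have := hmax ⟨(by omega : n < j), hne⟩ (by omega)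
          omega
      have hlj' := hconst j hlj le_rfl
      have hmem : γ (s j) ∈ (f l).pts := hlj' ▸ hf.mem_right (by omega)
      have hv : γ (s j) ∉ P.carrier.exposedPoints ℝ := by
        refine (h.isGeodesicAt (hf.nonneg l) (hf.mono hlj.le) (hf.mono (Nat.le_succ j))
          (hf.le_last _)).notMem_exposedPoints (hf.mem_left (by omega)) hmem
          (hf.mem_left hjk) (hf.mem_right hjk) ?_ hj.symm
        rwa [← hlj']
      have hjl := hdet l j hlj hjk hmem hv
      subst hjl
      have hDl : D l = D (l + 1) := by
        have h1 := (hψ l (by omega)).straight (γ (s (l + 1))) ⟨hmem, hf.mem_left hjk⟩ (γ (s l))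
          (hf.mem_left (by omega)) (γ (s (l + 1 + 1))) (hf.mem_right hjk) hl hj.symm
          fun d hd hd' => (h.isGeodesicAt (hf.nonneg l) (hf.mono hlj.le)
            (hf.mono (Nat.le_succ (l + 1))) (hf.le_last _)).inner_eq_zero
            (hf.mem_left (by omega)) hmem (hf.mem_left hjk) (hf.mem_right hjk) hl hj.symm hd hd'
        simp only [hD]
        rw [h1, dist_comm]
      rcases (Nat.lt_succ_iff.1 hij).eq_or_lt with h2 | h2
      · rw [h2, hDl]
      · rw [ih l hlj (by omega) i h2 hi hl, hDl]
  obtain ⟨U, hU⟩ : ∃ U : E2, ∀ i ≤ k, γ (s i) ≠ γ (s (i + 1)) → D i = U := by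
    by_cases hex : ∃ i ≤ k, γ (s i) ≠ γ (s (i + 1))
    · obtain ⟨i, hik, hi⟩ := hex
      refine ⟨D i, fun j hjk hj => ?_⟩
      rcases lt_trichotomy i j with h1 | h1 | h1
      · exact (hstep j hjk i h1 hi hj).symm
      · rw [h1]
      · exact hstep i hik j h1 hj hi
    · push Not at hex
      exact ⟨0, fun i hik hi => absurd (hex i hik) hi⟩
  have hpiece : ∀ i ≤ k, ψ i (γ (s i)) = ψ 0 p + lengthTo γ (s i) • U →
      ∀ t ∈ Icc (s i) (s (i + 1)), ψ i (γ t) = ψ 0 p + lengthTo γ t • U := by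
    intro i hik h0 t ht
    have h1 := h.lengthTo_sub_eq (hf.nonneg i) ht.1 (ht.2.trans (hf.le_last _))
      (hf.mem_left hik) (hf.mem i hik t ht)
    obtain ⟨c, hc, hct⟩ := h.wbtw (hf.nonneg i) ht.1 ht.2 (hf.le_last _) (hf.mem_left hik)
      (hf.mem_right hik)
    have h2 : ψ i (γ t) - ψ i (γ (s i)) = c • (ψ i (γ (s (i + 1))) - ψ i (γ (s i))) := by
      rw [← hct, AffineMap.apply_lineMap, AffineMap.lineMap_apply]
      simp
    have h3 : dist (γ (s i)) (γ t) = c * dist (γ (s i)) (γ (s (i + 1))) := by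
      rw [← hct, dist_left_lineMap, Real.norm_of_nonneg hc.1]
    have h4 : ψ i (γ (s (i + 1))) - ψ i (γ (s i)) = dist (γ (s i)) (γ (s (i + 1))) • U := by
      by_cases hi : γ (s i) = γ (s (i + 1))
      · rw [← hi]; simp
      · rw [← hU i hik hi, hD, smul_smul, mul_inv_cancel₀ (dist_ne_zero.2 hi), one_smul]
    rw [h4, smul_smul, ← h3, ← h1, sub_smul, h0] at h2
    rw [sub_eq_iff_eq_add] at h2
    rw [h2]
    abel
  refine ⟨U, fun i hik => hpiece i hik ?_⟩
  induction i with
  | zero => rw [hf.zero, h.1.source, lengthTo_zero, zero_smul, add_zero]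
  | succ i ih =>
    rw [← (hψ i (by omega)).glued _ ⟨hf.mem_right (by omega), hf.mem_left hik⟩]
    exact hpiece i (by omega) (ih (by omega)) _ (right_mem_Icc.2 (hf.mono (Nat.le_succ i)))

end IsShortestPath

end ConvexUnitPolyhedron

/-! ### Assembly of the landscape, its orientation and the trail. -/

theorem mainTheorem5 (P : ConvexUnitPolyhedron) (Fn Fm Fr : P.Face)
    (hm : Fm ≠ Fn) (hr : P.faceGraph.Adj Fn Fr)
    (p₁ p₂ : E3) (hp₁ : p₁ ∈ Fn.pts \ Fm.pts) (hp₂ : p₂ ∈ Fm.pts \ Fn.pts) :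
    (∃ γ : ℝ → E3, P.IsShortestPath p₁ p₂ γ) ∧
    ∀ γ : ℝ → E3, P.IsShortestPath p₁ p₂ γ →
      ∃ (L : P.Landscape Fn Fm) (O : ConvexUnitPolyhedron.Orientation L Fn Fr),
        O.IsFoldedTrail p₁ p₂ γ := by
  refine ⟨ConvexUnitPolyhedron.exists_isShortestPath (Fn.subset_surface hp₁.1)
    (Fm.subset_surface hp₂.1), fun γ hγ => ?_⟩
  have hp : p₁ ≠ p₂ := fun h => hp₂.2 (h ▸ hp₁.1)
  obtain ⟨k, f, s, rfl, rfl, hf, hne, hdet⟩ := hγ.exists_isFaceSeq_injOn hp₁.1 hp₂.1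
  have hk : 1 ≤ k := by
    by_contra hk
    exact hm (by rw [show k = 0 by omega])
  obtain ⟨L, hLk, hLf⟩ := ConvexUnitPolyhedron.exists_landscape hk hf.adj hne
  obtain ⟨ψ₀, hψ₀, hbase, hupper⟩ := ConvexUnitPolyhedron.exists_base_placement hr
  obtain ⟨ψ, rfl, hψ, hunf⟩ := ConvexUnitPolyhedron.exists_unfolding hf.adj hψ₀
  obtain ⟨U, hU⟩ := hγ.exists_direction hf hdet hunf
  -- An orientation places faces, not indices; the index is recovered because the faces do not
  -- repeat.
  obtain ⟨idx, hidx⟩ : ∃ idx : P.Face → ℕ, ∀ i ≤ k, idx (f i) = i := by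
    refine ⟨Function.invFunOn f (Iic k), fun i hi => ?_⟩
    refine InjOn.leftInvOn_invFunOn (fun a ha b hb hab => ?_) hi
    by_contra h
    rcases Nat.lt_or_gt_of_ne h with h | h
    · exact hne a b h hb hab
    · exact hne b a h ha hab.symm
  have hplace : ∀ i ≤ k, ψ (idx (f i)) = ψ i := fun i hi => by rw [hidx i hi]
  let O : ConvexUnitPolyhedron.Orientation L (f 0) Fr :=
    { mem := ⟨0, Nat.zero_le _, hLf 0 (Nat.zero_le _)⟩
      adj := hr
      place := fun F x => ψ (idx F) x
      isometric := fun i hi x hx y hy => by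
        rw [hLk] at hi
        rw [hLf i hi] at hx hy ⊢
        rw [hplace i hi]
        exact (hψ i hi).dist_eq hx hy
      glued := fun i hi x hx => by
        rw [hLk] at hi
        rw [hLf i hi.le, hLf (i + 1) hi] at hx ⊢
        rw [hplace i hi.le, hplace (i + 1) hi]
        exact (hunf i hi).glued x hx
      opposite := fun i hi a b hab x hx y hy => by
        rw [hLk] at hi
        rw [hLf i hi.le] at hab hx ⊢
        rw [hLf (i + 1) hi] at hab hy ⊢
        rw [hplace i hi.le, hplace (i + 1) hi]
        exact (hunf i hi).opposite a b hab x hx y hy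
      base := by
        rw [hplace 0 (Nat.zero_le k)]
        exact hbase
      upper := by
        rw [hplace 0 (Nat.zero_le k)]
        exact hupper }
  refine ⟨L, O, ?_⟩
  set ℓ := ConvexUnitPolyhedron.lengthTo γ 1 with hℓ
  have hℓ0 : 0 < ℓ := by
    have h1 := hγ.dist_le_lengthTo_sub le_rfl zero_le_one le_rfl
    rw [hγ.1.source, hγ.1.target, ConvexUnitPolyhedron.IsShortestPath.lengthTo_zero, sub_zero] at h1
    exact (dist_pos.2 hp).trans_le h1
  set φ : ℝ → ℝ := fun t => ConvexUnitPolyhedron.lengthTo γ t / ℓ with hφ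
  have hφm : MonotoneOn φ (Icc 0 1) := fun a ha b hb hab =>
    div_le_div_of_nonneg_right (hγ.monotoneOn_lengthTo ha hb hab) hℓ0.le
  have hφc : ContinuousOn φ (Icc 0 1) := (hγ.continuousOn_lengthTo hf).div_const ℓ
  have hφ0 : φ 0 = 0 := by simp [hφ, ConvexUnitPolyhedron.IsShortestPath.lengthTo_zero]
  have hφ1 : φ 1 = 1 := div_self hℓ0.ne'
  have hs01 : ∀ i, s i ∈ Icc (0 : ℝ) 1 := fun i => ⟨hf.nonneg i, hf.le_last i⟩
  -- `φ` is constant only while the path rests. This covers the times outside `[s i, s (i + 1)]`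
  -- whose parameter nevertheless lies in the `i`-th interval.
  have hconst : ∀ a ∈ Icc (0 : ℝ) 1, ∀ b ∈ Icc (0 : ℝ) 1, a ≤ b → φ b ≤ φ a →
      γ a = γ b ∧ ConvexUnitPolyhedron.lengthTo γ a = ConvexUnitPolyhedron.lengthTo γ b := by
    intro a ha b hb hab hle
    have h1 := hγ.dist_le_lengthTo_sub ha.1 hab hb.2
    have h2 := (div_le_div_iff_of_pos_right hℓ0).1 hle
    have h3 := hγ.monotoneOn_lengthTo ha hb hab
    exact ⟨dist_le_zero.1 (by linarith), le_antisymm h3 h2⟩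
  have hq : ψ k p₂ = ψ 0 p₁ + ℓ • U := by
    have h1 := hU k le_rfl (s (k + 1)) (right_mem_Icc.2 (hf.mono (Nat.le_succ k)))
    rwa [hf.last (k + 1) (by omega), hγ.1.target] at h1
  have hline : ∀ t, ψ 0 p₁ + ConvexUnitPolyhedron.lengthTo γ t • U =
      AffineMap.lineMap (O.place (f 0) p₁) (O.place (f k) p₂) (φ t) := by
    intro t
    change _ = AffineMap.lineMap (ψ (idx (f 0)) p₁) (ψ (idx (f k)) p₂) (φ t)
    rw [hplace 0 (Nat.zero_le k), hplace k le_rfl, hq, AffineMap.lineMap_apply]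
    rw [vsub_eq_sub, add_sub_cancel_left, smul_smul, hφ, div_mul_cancel₀ _ hℓ0.ne', vadd_eq_add,
      add_comm]
  have hmain : ∀ i ≤ L.len, ∀ t ∈ Icc (0 : ℝ) 1, φ t ∈ Icc (φ (s i)) (φ (s (i + 1))) →
      γ t ∈ (L.face i).pts ∧ O.place (L.face i) (γ t) =
        AffineMap.lineMap (O.place (f 0) p₁) (O.place (f k) p₂) (φ t) := by
    intro i hi t ht htφ
    rw [hLk] at hi
    rw [hLf i hi, ← hline t]
    change _ ∧ ψ (idx (f i)) (γ t) = _
    rw [hplace i hi]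
    obtain ⟨r, hr, hrγ, hrl⟩ : ∃ r ∈ Icc (s i) (s (i + 1)), γ r = γ t ∧
        ConvexUnitPolyhedron.lengthTo γ r = ConvexUnitPolyhedron.lengthTo γ t := by
      have hmono := hf.mono (Nat.le_succ i)
      rcases lt_or_ge t (s i) with h1 | h1
      · obtain ⟨h2, h3⟩ := hconst t ht (s i) (hs01 i) h1.le htφ.1
        exact ⟨s i, left_mem_Icc.2 hmono, h2.symm, h3.symm⟩
      rcases lt_or_ge (s (i + 1)) t with h2 | h2
      · obtain ⟨h3, h4⟩ := hconst (s (i + 1)) (hs01 _) t ht h2.le htφ.2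
        exact ⟨s (i + 1), right_mem_Icc.2 hmono, h3, h4⟩
      · exact ⟨t, ⟨h1, h2⟩, rfl, rfl⟩
    rw [← hrγ, ← hrl]
    exact ⟨hf.mem i hi r hr, hU i hi r hr⟩
  have hτ : Monotone fun i => φ (s i) := fun a b hab => hφm (hs01 a) (hs01 b) (hf.mono hab)
  refine ⟨?_, fun i => φ (s i), hτ, by simp only [hf.zero, hφ0], ?_, φ, hφm, hφc, hφ0, hφ1, hmain⟩
  · intro z hz
    rw [ConvexUnitPolyhedron.Orientation.trail, segment_eq_image_lineMap] at hz
    obtain ⟨c, hc, rfl⟩ := hz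
    obtain ⟨t, ht, rfl⟩ : c ∈ φ '' Icc 0 1 := by
      refine intermediate_value_Icc zero_le_one hφc ?_
      rwa [hφ0, hφ1]
    obtain ⟨i, hi, hti⟩ : ∃ i ≤ k, t ∈ Icc (s i) (s (i + 1)) := by
      by_contra! hno
      have h1 : ∀ j ≤ k + 1, s j ≤ t := by
        intro j
        induction j with
        | zero => exact fun _ => hf.zero ▸ ht.1
        | succ j ih =>
          intro hj
          by_contra! h2
          exact hno j (by omega) ⟨ih (by omega), h2.le⟩
      have h2 := h1 k (by omega)
      refine hno k le_rfl ⟨h2, ?_⟩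
      rw [hf.last (k + 1) (by omega)]
      exact ht.2
    have hti' : φ t ∈ Icc (φ (s i)) (φ (s (i + 1))) :=
      ⟨hφm (hs01 i) ht hti.1, hφm ht (hs01 _) hti.2⟩
    obtain ⟨h1, h2⟩ := hmain i (hi.trans hLk.ge) t ht hti'
    exact ⟨i, hi.trans hLk.ge, γ t, h1, h2⟩
  · dsimp only
    rw [hLk, hf.last (k + 1) (by omega), hφ1]
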